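/- Let $a<b$ be real numbers, $I=[a,b]$, $q>1$, and let $g:I\to\mathbb{R}$ have finite $q$-variation, i.e. $\sup\big(\sum_{i=1}^m|g(t_i)-g(t_{i-1})|^q\big)^{1/q}<\infty$, the supremum being over all $m$ and all $t_0<t_1<\dots<t_m$ in $I$. Assume $g(a)=g(b)$. Let $\alpha\in(1-1/q,1]$ and $c\in I$, and write $$[f]_{C^\alpha}=\sup_{s\ne t\in I}\frac{|f(t)-f(s)|}{|t-s|^\alpha},\qquad \|f\|_{C^\alpha}=|f(c)|+[f]_{C^\alpha},\qquad C^\alpha(I)=\{f:I\to\mathbb{R}:[f]_{C^\alpha}<\infty\}.$$ Then for every $f\in C^\alpha(I)$ the Young integral $\int_I f\,dg$ exists, that is, the sums $\sum_{i=1}^m f(t_{i-1})(g(t_i)-g(t_{i-1}))$ over partitions $a=t_0<\dots<t_m=b$ converge to a real number $\int_I f\,dg$ as the mesh $\max_i(t_i-t_{i-1})$ tends to $0$. Let $$\|g\|_{\mathsf{W}_\alpha}=\sup\Big\{\int_I f\,dg : \|f\|_{C^\alpha}\le 1\Big\}.$$ This supremum is finite, it equals $\sup\{\int_I f\,dg :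 [f]_{C^\alpha}\le 1\}$, and it is attained by some $f:I\to\mathbb{R}$ with $\|f\|_{C^\alpha}\le1$ and $[f]_{C^\alpha}=1$. Moreover $$\|g\|_{\mathsf{W}_\alpha}=\min_{\pi\in\Gamma_\alpha(g)}\int_{I\times I}|t-s|^\alpha\,\pi(ds,dt)<\infty ,$$ where $\Gamma_\alpha(g)$ is the set of all positive Borel measures $\pi$ on $I\times I$ (not necessarily finite) such that $\int_{I\times I}|t-s|^\alpha\,\pi(ds,dt)<\infty$ and $\int_{I\times I}(f(t)-f(s))\,\pi(ds,dt)=\int_I f\,dg$ for every $f\in C^\alpha(I)$. In particular, $\Gamma_\alpha(g)$ is non-empty and the minimum is attained. -/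

import Mathlib

open Filter Topology MeasureTheory
open scoped ENNReal

namespace KantorovichYoung

noncomputable section

/-- The Hölder semi-norm of exponent `α` of a function on `[a, b]`, with values in `[0, ∞]`:
the supremum of `|f t - f s| / |t - s| ^ α` over `s ≠ t`. -/
def holderSeminorm {a b : ℝ} (α : ℝ) (f : Set.Icc a b → ℝ) : ℝ≥0∞ :=
  ⨆ (s : Set.Icc a b) (t : Set.Icc a b) (_ : s ≠ t),
    ENNReal.ofReal (|f t - f s| / |(t : ℝ) - (s : ℝ)| ^ α)

/-- The Hölder norm with base point `c`: the value `|f c|` plus the Hölder semi-norm. -/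
def holderNorm {a b : ℝ} (c : Set.Icc a b) (α : ℝ) (f : Set.Icc a b → ℝ) : ℝ≥0∞ :=
  ENNReal.ofReal |f c| + holderSeminorm α f

/-- The `p`-variation semi-norm of a function on `[a, b]`, with values in `[0, ∞]`. -/
def pVariation {a b : ℝ} (p : ℝ) (f : Set.Icc a b → ℝ) : ℝ≥0∞ :=
  ⨆ (m : ℕ) (t : Fin (m + 1) → Set.Icc a b) (_ : StrictMono t),
    ENNReal.ofReal ((∑ i : Fin m, |f (t i.succ) - f (t i.castSucc)| ^ p) ^ (1 / p))

/-- A partition `a = t₀ < t₁ < ⋯ < tₘ = b` of `[a, b]`. -/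
structure Partition (a b : ℝ) where
  /-- The number of sub-intervals. -/
  m : ℕ
  /-- The points of the partition. -/
  t : Fin (m + 1) → Set.Icc a b
  strictMono : StrictMono t
  first : (t 0 : ℝ) = a
  last : (t (Fin.last m) : ℝ) = b

/-- The mesh of a partition: the largest length of a sub-interval. -/
def Partition.mesh {a b : ℝ} (P : Partition a b) : ℝ :=
  ⨆ i : Fin P.m, ((P.t i.succ : ℝ) - (P.t i.castSucc : ℝ))

/-- The left-point Riemann–Stieltjes sum of `f` against `g` along a partition. -/
def Partition.sum {a b : ℝ} (f g : Set.Icc a b → ℝ) (P : Partition a b) : ℝ :=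
  ∑ i : Fin P.m, f (P.t i.castSucc) * (g (P.t i.succ) - g (P.t i.castSucc))

/-- `∫ f dg` exists over `[a, b]` in the sense of Young and equals `L`: the Riemann–Stieltjes sums
tend to `L` as the mesh of the partition tends to zero. -/
def HasYoungIntegral {a b : ℝ} (f g : Set.Icc a b → ℝ) (L : ℝ) : Prop :=
  Tendsto (Partition.sum f g) (comap Partition.mesh (𝓝 0)) (𝓝 L)

/-- The set of all `∫ f dg` with `f` of Hölder norm (with base point `c`) at most one. -/
def normBallValues {a b : ℝ} (c : Set.Icc a b) (α : ℝ) (g : Set.Icc a b → ℝ) : Set ℝ :=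
  {L | ∃ f : Set.Icc a b → ℝ, holderNorm c α f ≤ 1 ∧ HasYoungIntegral f g L}

/-- The set of all `∫ f dg` with `f` of Hölder semi-norm at most one. -/
def seminormBallValues {a b : ℝ} (α : ℝ) (g : Set.Icc a b → ℝ) : Set ℝ :=
  {L | ∃ f : Set.Icc a b → ℝ, holderSeminorm α f ≤ 1 ∧ HasYoungIntegral f g L}

/-- The Kantorovich–Young norm of `g`: the supremum of `∫ f dg` over the unit ball of the Hölder
norm with base point `c`. -/
def kantorovichYoung {a b : ℝ} (c : Set.Icc a b) (α : ℝ) (g : Set.Icc a b → ℝ) : ℝ :=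
  sSup (normBallValues c α g)

/-- The `α`-energy `∫ |t - s| ^ α π(ds, dt)` of a Borel measure on `[a, b] × [a, b]`. -/
def energy {a b : ℝ} (α : ℝ) (π : Measure (Set.Icc a b × Set.Icc a b)) : ℝ≥0∞ :=
  ∫⁻ x, ENNReal.ofReal (|(x.2 : ℝ) - (x.1 : ℝ)| ^ α) ∂π

/-- The couplings for `g` with finite `α`-energy: Borel measures `π` on `[a, b] × [a, b]`, not
necessarily finite, of finite `α`-energy, such that `∫ (f t - f s) π(ds, dt) = ∫ f dg` for every
`α`-Hölder function `f`. (The left-hand side is absolutely convergent, because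
`|f t - f s|` is at most a constant times `|t - s| ^ α`.) -/
def couplings {a b : ℝ} (α : ℝ) (g : Set.Icc a b → ℝ) :
    Set (Measure (Set.Icc a b × Set.Icc a b)) :=
  {π | energy α π < ∞ ∧ ∀ f : Set.Icc a b → ℝ, holderSeminorm α f < ∞ →
    HasYoungIntegral f g (∫ x, (f x.2 - f x.1) ∂π)}

end

end KantorovichYoung

/-! Existence of the integral is Young's argument. Deleting a point of a partition changes the
Riemann sum by one product of increments. A pigeonhole choice of the point makes the successive
changes summable, since `α + 1 / q > 1`. The resulting error bound (`YoungData.abs_sum_sub_le`)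
depends on `f` only through its Hölder constant, so the integral is continuous for pointwise
convergence on Hölder balls. Because `g a = g b`, constants integrate to zero and `f` may be
normalised by `f c = 0`. The normalised unit ball is compact for pointwise convergence, which gives
a maximiser with value `W`.

Every coupling has energy at least `W`, since `f t - f s ≤ |t - s| ^ α` for the maximiser. It
remains to find a coupling of energy at most `W`.

For `α < 1`, the difference quotient of a Lipschitz function extends continuously by zero to the
diagonal. The integral is thus a functional on a subspace of continuous functions, bounded by `W`
times the norm of the positive part. Hahn–Banach and Riesz–Markov–Kakutani represent it by a measure
of mass at most `W`. Weighting this measure by `|t - s| ^ (-α)` gives the coupling, and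
approximation by Lipschitz functions extends the identity to all Hölder functions.

For `α = 1` that continuity fails, and the coupling is explicit. Summation by parts turns `∫ f dg`
into `-∫ (g - g a) df`. The positive and negative parts of `g - g a` are increasing limits of dyadic
step functions, that is, sums of non-negative multiples of indicators of dyadic intervals. Each
indicator, integrated against `df`, is the increment of `f` between two end points, hence an atom of
the coupling. The energy is the limit of the lower sums of the two parts, and test functions with
slopes `±1` bound it by `W`. -/

namespace KantorovichYoung

noncomputable section

/-! ### Superadditive control of the `q`-variation -/

section Control

variable {X : Type*}

/-- The sequence `u` with the term of index `j` left out. -/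
def skip (u : ℕ → X) (j : ℕ) : ℕ → X := fun i => if i < j then u i else u (i + 1)

lemma skip_of_lt (u : ℕ → X) {i j : ℕ} (h : i < j) : skip u j i = u i := if_pos h

lemma skip_of_le (u : ℕ → X) {i j : ℕ} (h : j ≤ i) : skip u j i = u (i + 1) :=
  if_neg (not_lt.2 h)

lemma skip_mem {u : ℕ → X} {S : Set X} (hu : ∀ i, u i ∈ S) (j i : ℕ) : skip u j i ∈ S := by
  unfold skip; split_ifs <;> exact hu _

lemma monotone_skip [Preorder X] {u : ℕ → X} (hu : Monotone u) (j : ℕ) : Monotone (skip u j) := by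
  refine monotone_nat_of_le_succ fun n => ?_
  unfold skip
  split_ifs <;> exact hu (by lia)

/-- Deleting an interior point has a purely local effect. For `φ x y = f x * (g y - g x)` the defect
is the product of the increment of `f` on the left of the point and that of `g` on its right. -/
lemma sum_skip (φ : X → X → ℝ) (u : ℕ → X) {n j : ℕ} (hj : j < n) :
    ∑ i ∈ Finset.range (n + 1), φ (u i) (u (i + 1)) =
      ∑ i ∈ Finset.range n, φ (skip u (j + 1) i) (skip u (j + 1) (i + 1)) + φ (u j) (u (j + 1)) +
        φ (u (j + 1)) (u (j + 2)) - φ (u j) (u (j + 2)) := by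
  induction n, (Nat.succ_le_of_lt hj) using Nat.le_induction with
  | base =>
    rw [Nat.succ_eq_add_one, Finset.sum_range_succ, Finset.sum_range_succ,
      Finset.sum_range_succ (n := j), skip_of_lt u (lt_add_one j), skip_of_le u le_rfl]
    have : ∑ i ∈ Finset.range j, φ (skip u (j + 1) i) (skip u (j + 1) (i + 1)) =
        ∑ i ∈ Finset.range j, φ (u i) (u (i + 1)) := by
      refine Finset.sum_congr rfl fun i hi => ?_
      rw [Finset.mem_range] at hi
      rw [skip_of_lt u (by lia), skip_of_lt u (by lia)]
    rw [this]; ring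
  | succ n hn ih =>
    rw [Finset.sum_range_succ, ih (by lia), Finset.sum_range_succ (n := n),
      skip_of_le u (by lia : j + 1 ≤ n), skip_of_le u (by lia : j + 1 ≤ n + 1)]
    ring

/-- The sum of the `q`-th powers of the first `n` increments of `g` along `u`. -/
def varSum (q : ℝ) (g : X → ℝ) (u : ℕ → X) (n : ℕ) : ℝ :=
  ∑ i ∈ Finset.range n, |g (u (i + 1)) - g (u i)| ^ q

lemma varSum_nonneg (q : ℝ) (g : X → ℝ) (u : ℕ → X) (n : ℕ) : 0 ≤ varSum q g u n :=
  Finset.sum_nonneg fun _ _ => by positivity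

variable [LinearOrder X]

/-- The supremum of `varSum` over the monotone sequences between `s` and `t`. -/
def control (q : ℝ) (g : X → ℝ) (s t : X) : ℝ :=
  ⨆ p : ℕ × {u : ℕ → X // Monotone u ∧ ∀ i, u i ∈ Set.Icc s t}, varSum q g p.2 p.1

lemma control_nonneg (q : ℝ) (g : X → ℝ) (s t : X) : 0 ≤ control q g s t :=
  Real.iSup_nonneg fun _ => varSum_nonneg _ _ _ _

variable {q V : ℝ} {g : X → ℝ}

lemma varSum_le_control (hV : ∀ (n : ℕ) (u : ℕ → X), Monotone u → varSum q g u n ≤ V) {s t : X}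
    (n : ℕ) {u : ℕ → X} (hu : Monotone u) (hus : ∀ i, u i ∈ Set.Icc s t) :
    varSum q g u n ≤ control q g s t := by
  refine le_ciSup
    (f := fun p : ℕ × {u : ℕ → X // Monotone u ∧ ∀ i, u i ∈ Set.Icc s t} => varSum q g p.2 p.1)
    ⟨V, ?_⟩ (n, ⟨u, hu, hus⟩)
  rintro _ ⟨p, rfl⟩
  exact hV _ _ p.2.2.1

lemma control_le (hV : ∀ (n : ℕ) (u : ℕ → X), Monotone u → varSum q g u n ≤ V) (s t : X) :
    control q g s t ≤ V := by
  have hV0 : 0 ≤ V := (varSum_nonneg q g (fun _ => s) 0).trans (hV 0 _ monotone_const)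
  exact Real.iSup_le (fun p => hV _ _ p.2.2.1) hV0

lemma abs_sub_rpow_le_control (hV : ∀ (n : ℕ) (u : ℕ → X), Monotone u → varSum q g u n ≤ V)
    {s t x y : X} (hx : x ∈ Set.Icc s t) (hy : y ∈ Set.Icc s t) :
    |g x - g y| ^ q ≤ control q g s t := by
  have key : ∀ {x y : X}, x ∈ Set.Icc s t → y ∈ Set.Icc s t → y ≤ x →
      |g x - g y| ^ q ≤ control q g s t := by
    intro x y hx hy hxy
    have hm : Monotone (fun i : ℕ => if i = 0 then y else x) := by
      refine monotone_nat_of_le_succ fun n => ?_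
      rcases n with _ | n <;> simp [hxy]
    have := varSum_le_control hV 1 hm (s := s) (t := t) (fun i => by
      split_ifs <;> assumption)
    simpa [varSum] using this
  rcases le_total y x with h | h
  · exact key hx hy h
  · rw [abs_sub_comm]; exact key hy hx h

/-- Sequences in the two adjacent intervals concatenate, and the joining increment only adds a
non-negative term. -/
lemma control_add_le
    (hV : ∀ (n : ℕ) (u : ℕ → X), Monotone u → varSum q g u n ≤ V) {s x t : X}
    (hsx : s ≤ x) (hxt : x ≤ t) : control q g s x + control q g x t ≤ control q g s t := by
  have : Nonempty {u : ℕ → X // Monotone u ∧ ∀ i, u i ∈ Set.Icc s x} :=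
    ⟨⟨fun _ => s, monotone_const, fun _ => ⟨le_rfl, hsx⟩⟩⟩
  have : Nonempty {u : ℕ → X // Monotone u ∧ ∀ i, u i ∈ Set.Icc x t} :=
    ⟨⟨fun _ => x, monotone_const, fun _ => ⟨le_rfl, hxt⟩⟩⟩
  rw [← le_sub_iff_add_le]
  refine ciSup_le fun ⟨n, u, hu, hus⟩ => ?_
  rw [le_sub_comm]
  refine ciSup_le fun ⟨m, v, hv, hvs⟩ => ?_
  rw [le_sub_iff_add_le]
  -- The `n` increments of `u` use the points `0, …, n`, so `v` starts at index `n + 1`.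
  set w : ℕ → X := fun i => if i ≤ n then u i else v (i - (n + 1)) with hw
  have hwm : Monotone w := by
    refine monotone_nat_of_le_succ fun i => ?_
    simp only [hw]
    split_ifs
    · exact hu (by lia)
    · exact (hus _).2.trans (hvs _).1
    · lia
    · exact hv (by lia)
  have hws : ∀ i, w i ∈ Set.Icc s t := by
    intro i
    simp only [hw]
    split_ifs
    · exact ⟨(hus _).1, (hus _).2.trans hxt⟩
    · exact ⟨hsx.trans (hvs _).1, (hvs _).2⟩
  refine le_trans ?_ (varSum_le_control hV (n + 1 + m) hwm hws)
  have h1 : ∑ i ∈ Finset.range n, |g (w (i + 1)) - g (w i)| ^ q = varSum q g u n := by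
    refine Finset.sum_congr rfl fun i hi => ?_
    rw [Finset.mem_range] at hi
    simp only [hw]
    rw [if_pos (by lia), if_pos (by lia)]
  have h2 : ∑ i ∈ Finset.range m, |g (w (n + 1 + i + 1)) - g (w (n + 1 + i))| ^ q =
      varSum q g v m := by
    refine Finset.sum_congr rfl fun i _ => ?_
    simp only [hw]
    rw [if_neg (by lia), if_neg (by lia)]
    congr 5 <;> lia
  have h3 : varSum q g w (n + 1 + m) = varSum q g u n + |g (w (n + 1)) - g (w n)| ^ q +
      varSum q g v m := by
    rw [varSum, Finset.sum_range_add, Finset.sum_range_succ, h1, h2]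
  have : 0 ≤ |g (w (n + 1)) - g (w n)| ^ q := by positivity
  rw [h3]
  dsimp only
  linarith

lemma sum_control_le
    (hV : ∀ (n : ℕ) (u : ℕ → X), Monotone u → varSum q g u n ≤ V) {u : ℕ → X} (hu : Monotone u)
    (n : ℕ) : ∑ i ∈ Finset.range n, control q g (u i) (u (i + 1)) ≤ control q g (u 0) (u n) := by
  induction n with
  | zero => simpa using control_nonneg q g (u 0) (u 0)
  | succ n ih =>
    rw [Finset.sum_range_succ]
    have := control_add_le hV (hu (Nat.zero_le n)) (hu n.le_succ)
    simp only [Nat.succ_eq_add_one] at this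
    linarith

end Control

/-! ### Young's inequality by deleting points -/

section Young

/-- The normalised sum of all `x i / h + y i / v` is at most two, so some index has a term at most
the average, and there both bounds hold at once. -/
lemma exists_le_div_of_sum_le {n : ℕ} {x y : ℕ → ℝ} {h v : ℝ} (hx : ∀ i, 0 ≤ x i)
    (hy : ∀ i, 0 ≤ y i) (hxs : ∑ i ∈ Finset.range (n + 1), x i ≤ h)
    (hys : ∑ i ∈ Finset.range (n + 1), y i ≤ v) :
    ∃ j < n + 1, x j ≤ 2 / (n + 1) * h ∧ y j ≤ 2 / (n + 1) * v := by
  have hh : 0 ≤ h := (Finset.sum_nonneg fun i _ => hx i).trans hxs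
  have hv : 0 ≤ v := (Finset.sum_nonneg fun i _ => hy i).trans hys
  have hsum : ∑ i ∈ Finset.range (n + 1), (x i / h + y i / v) ≤
      ∑ i ∈ Finset.range (n + 1), (2 / (n + 1) : ℝ) := by
    rw [Finset.sum_add_distrib, ← Finset.sum_div, ← Finset.sum_div, Finset.sum_const,
      Finset.card_range, nsmul_eq_mul]
    have h1 := div_le_one_of_le₀ hxs hh
    have h2 := div_le_one_of_le₀ hys hv
    push_cast
    rw [mul_div_cancel₀ _ (by positivity)]
    linarith
  obtain ⟨j, hj, hle⟩ := Finset.exists_le_of_sum_le (by simp) hsum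
  rw [Finset.mem_range] at hj
  have aux : ∀ {z : ℕ → ℝ} {c : ℝ}, (∀ i, 0 ≤ z i) → 0 ≤ c →
      ∑ i ∈ Finset.range (n + 1), z i ≤ c → z j / c ≤ 2 / (n + 1) → z j ≤ 2 / (n + 1) * c := by
    intro z c hz hc hzs hzj
    -- For a zero total the quotient carries no information, but then the term itself is at most the
    -- total.
    rcases hc.eq_or_lt with rfl | hc
    · rw [mul_zero]
      exact (Finset.single_le_sum (fun i _ => hz i) (Finset.mem_range.2 hj)).trans hzs
    · rwa [div_le_iff₀ hc] at hzj
  have h1 : 0 ≤ x j / h := div_nonneg (hx j) hh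
  have h2 : 0 ≤ y j / v := div_nonneg (hy j) hv
  exact ⟨j, hj, aux hx hh hxs (by linarith), aux hy hv hys (by linarith)⟩

variable {a b : ℝ}

/-- `f` is `α`-Hölder with constant `M`. -/
def IsHolder (M α : ℝ) (f : Set.Icc a b → ℝ) : Prop :=
  ∀ s t : Set.Icc a b, |f t - f s| ≤ M * |(t : ℝ) - s| ^ α

/-- The left-point sum of `f` against `g` along the first `n` steps of `u`. -/
def seqSum (f g : Set.Icc a b → ℝ) (u : ℕ → Set.Icc a b) (n : ℕ) : ℝ :=
  ∑ i ∈ Finset.range n, f (u i) * (g (u (i + 1)) - g (u i))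

/-- Interior points are deleted one at a time until a single increment is left, each time where the
defect is small. The variation hypothesis concerns sequences in the range of `u`, so it survives
deletion. -/
lemma abs_seqSum_sub_le {M α q : ℝ} (hM : 0 ≤ M) (hα : 0 < α) (hq : 0 < q)
    {f g : Set.Icc a b → ℝ} (hf : IsHolder M α f) (n : ℕ) (u : ℕ → Set.Icc a b) (hu : Monotone u)
    {h v : ℝ} (hh : (u (n + 1) : ℝ) - u 0 ≤ h)
    (hv : ∀ (m : ℕ) (w : ℕ → Set.Icc a b), Monotone w → (∀ i, w i ∈ Set.range u) →
      varSum q g w m ≤ v) :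
    |seqSum f g u (n + 1) - f (u 0) * (g (u (n + 1)) - g (u 0))| ≤
      M * h ^ α * v ^ (1 / q) * ∑ k ∈ Finset.range n, (2 / (k + 1 : ℝ)) ^ (α + 1 / q) := by
  induction n generalizing u with
  | zero => simp [seqSum]
  | succ n ih =>
    have hh0 : 0 ≤ h := le_trans (sub_nonneg.2 (hu (Nat.zero_le (n + 1 + 1)))) hh
    have hv0 : 0 ≤ v := le_trans (varSum_nonneg q g u 0) (hv 0 u hu fun i => ⟨i, rfl⟩)
    -- Time is measured to the left of the candidate point `u (j + 1)` and variation to its right,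
    -- matching the two factors of the defect.
    obtain ⟨j, hj, hxj, hyj⟩ := exists_le_div_of_sum_le (n := n)
      (x := fun i => (u (i + 1) : ℝ) - u i) (y := fun i => |g (u (i + 2)) - g (u (i + 1))| ^ q)
      (h := h) (v := v) (fun i => sub_nonneg.2 (hu i.le_succ)) (fun i => by positivity)
      (by
        rw [Finset.sum_range_sub (fun i => (u i : ℝ))]
        have : (u (n + 1) : ℝ) ≤ u (n + 1 + 1) := hu (Nat.le_succ _)
        linarith)
      (hv (n + 1) (fun i => u (i + 1)) (fun i k hik => hu (by lia)) fun i => ⟨i + 1, rfl⟩)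
    have h0 : skip u (j + 1) 0 = u 0 := skip_of_lt u (by lia)
    have hlast : skip u (j + 1) (n + 1) = u (n + 1 + 1) := skip_of_le u (by lia)
    have ih' := ih (skip u (j + 1)) (monotone_skip hu _) (by rwa [h0, hlast])
      (fun m w hw hws => hv m w hw fun i => by
        obtain ⟨k, hk⟩ := hws i
        rw [← hk]
        exact skip_mem (S := Set.range u) (fun i => ⟨i, rfl⟩) _ _)
    rw [h0, hlast] at ih'
    have hsum := sum_skip (fun x y => f x * (g y - g x)) u hj
    have hprod : |(f (u (j + 1)) - f (u j)) * (g (u (j + 2)) - g (u (j + 1)))| ≤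
        M * h ^ α * v ^ (1 / q) * (2 / (n + 1 : ℝ)) ^ (α + 1 / q) := by
      have e1 : |f (u (j + 1)) - f (u j)| ≤ M * (2 / (n + 1) * h) ^ α := by
        refine (hf _ _).trans (mul_le_mul_of_nonneg_left ?_ hM)
        have : (0 : ℝ) ≤ u (j + 1) - u j := sub_nonneg.2 (hu (Nat.le_succ _))
        rw [abs_of_nonneg this]
        exact Real.rpow_le_rpow this hxj hα.le
      have e2 : |g (u (j + 2)) - g (u (j + 1))| ≤ (2 / (n + 1) * v) ^ (1 / q) := by
        have := Real.rpow_le_rpow (by positivity) hyj (by positivity : 0 ≤ 1 / q)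
        rwa [← Real.rpow_mul (abs_nonneg _), mul_one_div_cancel hq.ne', Real.rpow_one] at this
      rw [abs_mul]
      refine (mul_le_mul e1 e2 (abs_nonneg _) (by positivity)).trans_eq ?_
      rw [Real.mul_rpow (by positivity) hh0, Real.mul_rpow (by positivity) hv0,
        Real.rpow_add (by positivity)]
      ring
    rw [Finset.sum_range_succ, mul_add]
    refine le_trans ?_ (add_le_add ih' hprod)
    refine le_trans (le_of_eq ?_) (abs_add_le _ _)
    congr 1
    unfold seqSum
    rw [hsum]
    ring

/-- The constant in Young's inequality. -/
def youngConst (θ : ℝ) : ℝ := ∑' k : ℕ, (2 / (k + 1 : ℝ)) ^ θ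

lemma youngConst_nonneg (θ : ℝ) : 0 ≤ youngConst θ := tsum_nonneg fun _ => by positivity

lemma sum_le_youngConst {θ : ℝ} (hθ : 1 < θ) (n : ℕ) :
    ∑ k ∈ Finset.range n, (2 / (k + 1 : ℝ)) ^ θ ≤ youngConst θ := by
  refine Summable.sum_le_tsum _ (fun _ _ => by positivity) ?_
  have h1 : Summable fun k : ℕ => (2 : ℝ) ^ θ * (1 / ((k + 1 : ℕ) : ℝ) ^ θ) :=
    ((summable_nat_add_iff 1).2 (Real.summable_one_div_nat_rpow.2 hθ)).mul_left _
  refine h1.congr fun k => ?_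
  rw [Real.div_rpow (by positivity) (by positivity)]
  push_cast
  ring

/-- Young's inequality on a single interval. -/
lemma abs_seqSum_sub_le_control {M α q V : ℝ} (hM : 0 ≤ M) (hα : 0 < α) (hq : 0 < q)
    (hθ : 1 < α + 1 / q) {f g : Set.Icc a b → ℝ} (hf : IsHolder M α f)
    (hV : ∀ (n : ℕ) (u : ℕ → Set.Icc a b), Monotone u → varSum q g u n ≤ V)
    (n : ℕ) (u : ℕ → Set.Icc a b) (hu : Monotone u) :
    |seqSum f g u n - f (u 0) * (g (u n) - g (u 0))| ≤
      youngConst (α + 1 / q) * M *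
        (((u n : ℝ) - u 0) ^ α * control q g (u 0) (u n) ^ (1 / q)) := by
  rcases n with _ | n
  · have := youngConst_nonneg (α + 1 / q)
    have := control_nonneg q g (u 0) (u 0)
    simp only [seqSum, Finset.range_zero, Finset.sum_empty, sub_self, mul_zero, abs_zero]
    positivity
  have hu0 : 0 ≤ (u (n + 1) : ℝ) - u 0 := sub_nonneg.2 (hu (Nat.zero_le (n + 1)))
  have hc := control_nonneg q g (u 0) (u (n + 1))
  -- Stopping the sequence keeps its range within the interval from `u 0` to `u (n + 1)`, where the
  -- control applies.
  set w : ℕ → Set.Icc a b := fun i => u (min i (n + 1)) with hw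
  have hwm : Monotone w := fun i j hij => hu (by lia)
  have hw0 : w 0 = u 0 := by simp [hw]
  have hwn : w (n + 1) = u (n + 1) := by simp [hw]
  have hS : seqSum f g w (n + 1) = seqSum f g u (n + 1) := by
    refine Finset.sum_congr rfl fun i hi => ?_
    rw [Finset.mem_range] at hi
    simp only [hw]
    rw [min_eq_left (by lia), min_eq_left (by lia)]
  have := abs_seqSum_sub_le hM hα hq hf n w hwm (h := (u (n + 1) : ℝ) - u 0)
    (v := control q g (u 0) (u (n + 1))) (by rw [hw0, hwn])
    (fun m z hz hzu => varSum_le_control hV m hz fun i => by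
      obtain ⟨k, hk⟩ := hzu i
      rw [← hk]
      exact ⟨hu (Nat.zero_le _), hu (min_le_right _ _)⟩)
  rw [hw0, hwn, hS] at this
  refine this.trans ?_
  have := mul_le_mul_of_nonneg_left (sum_le_youngConst hθ n)
    (by positivity : 0 ≤ M * ((u (n + 1) : ℝ) - u 0) ^ α *
      control q g (u 0) (u (n + 1)) ^ (1 / q))
  refine this.trans_eq (by ring)

/-- Comparison of the sums along a sequence and along a subsequence. -/
lemma abs_seqSum_comp_sub_le {M α q V : ℝ} (hM : 0 ≤ M) (hα : 0 < α) (hq : 0 < q)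
    (hθ : 1 < α + 1 / q) {f g : Set.Icc a b → ℝ} (hf : IsHolder M α f)
    (hV : ∀ (n : ℕ) (u : ℕ → Set.Icc a b), Monotone u → varSum q g u n ≤ V)
    (u : ℕ → Set.Icc a b) (hu : Monotone u) (k : ℕ → ℕ) (hk : Monotone k) (m : ℕ) :
    |seqSum f g (u ∘ k) m - (seqSum f g u (k m) - seqSum f g u (k 0))| ≤
      youngConst (α + 1 / q) * M * ∑ i ∈ Finset.range m,
        (((u (k (i + 1)) : ℝ) - u (k i)) ^ α *
          control q g (u (k i)) (u (k (i + 1))) ^ (1 / q)) := by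
  induction m with
  | zero => simp [seqSum]
  | succ m ih =>
    have key := abs_seqSum_sub_le_control hM hα hq hθ hf hV (k (m + 1) - k m)
      (fun i => u (k m + i)) (fun i j hij => hu (by lia))
    have hkm : k m + (k (m + 1) - k m) = k (m + 1) := Nat.add_sub_cancel' (hk m.le_succ)
    simp only [hkm, add_zero] at key
    have hsplit : seqSum f g u (k (m + 1)) = seqSum f g u (k m) +
        seqSum f g (fun i => u (k m + i)) (k (m + 1) - k m) := by
      conv_lhs => rw [← hkm]
      exact Finset.sum_range_add _ _ _
    have hstep : seqSum f g (u ∘ k) (m + 1) = seqSum f g (u ∘ k) m +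
        f (u (k m)) * (g (u (k (m + 1))) - g (u (k m))) := Finset.sum_range_succ _ _
    rw [Finset.sum_range_succ, mul_add, hsplit, hstep]
    refine le_trans ?_ (add_le_add ih key)
    rw [abs_sub_comm (seqSum f g (fun i => u (k m + i)) (k (m + 1) - k m))]
    refine le_trans (le_of_eq ?_) (abs_add_le _ _)
    congr 1
    ring

/-- The exponents in Young's inequality leave a positive power of the mesh. -/
lemma sum_rpow_mul_control_le {α q V δ : ℝ} (hq : 1 < q) (hαq : 1 - 1 / q ≤ α)
    {g : Set.Icc a b → ℝ}
    (hV : ∀ (n : ℕ) (u : ℕ → Set.Icc a b), Monotone u → varSum q g u n ≤ V)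
    (t : ℕ → Set.Icc a b) (ht : Monotone t) (m : ℕ) (hδ0 : 0 ≤ δ)
    (hδ : ∀ i < m, (t (i + 1) : ℝ) - t i ≤ δ) :
    ∑ i ∈ Finset.range m, (((t (i + 1) : ℝ) - t i) ^ α *
        control q g (t i) (t (i + 1)) ^ (1 / q)) ≤
      (b - a) ^ (1 - 1 / q) * V ^ (1 / q) * δ ^ (α - (1 - 1 / q)) := by
  have hq0 : 0 < q := by linarith
  have hV0 : 0 ≤ V := (varSum_nonneg q g t 0).trans (hV 0 t ht)
  have hd : ∀ i, 0 ≤ (t (i + 1) : ℝ) - t i := fun i => sub_nonneg.2 (ht i.le_succ)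
  have hc : ∀ i, 0 ≤ control q g (t i) (t (i + 1)) := fun i => control_nonneg _ _ _ _
  have hp : 0 < 1 - 1 / q := by rw [sub_pos, div_lt_one hq0]; exact hq
  have hba : (0 : ℝ) ≤ b - a := by have h1 := (t 0).2.1; have h2 := (t 0).2.2; linarith
  have hterm : ∀ i ∈ Finset.range m, ((t (i + 1) : ℝ) - t i) ^ α *
      control q g (t i) (t (i + 1)) ^ (1 / q) ≤ δ ^ (α - (1 - 1 / q)) *
        (((t (i + 1) : ℝ) - t i) ^ (1 - 1 / q) * control q g (t i) (t (i + 1)) ^ (1 / q)) := by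
    intro i hi
    have h1 := Real.rpow_le_rpow (hd i) (hδ i (Finset.mem_range.1 hi)) (sub_nonneg.2 hαq)
    have h2 : ((t (i + 1) : ℝ) - t i) ^ α = ((t (i + 1) : ℝ) - t i) ^ (α - (1 - 1 / q)) *
        ((t (i + 1) : ℝ) - t i) ^ (1 - 1 / q) := by
      rw [← Real.rpow_add_of_nonneg (hd i) (sub_nonneg.2 hαq) hp.le, sub_add_cancel]
    have := hd i
    have := hc i
    rw [h2, mul_assoc]
    gcongr
  refine (Finset.sum_le_sum hterm).trans ?_
  rw [← Finset.mul_sum, mul_comm]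
  refine mul_le_mul_of_nonneg_right ?_ (by positivity)
  -- Hölder's inequality with these conjugate exponents turns the factors into a telescoping sum of
  -- lengths and a superadditive sum of controls.
  have hpq : ((1 - 1 / q)⁻¹).HolderConjugate q := by
    rw [Real.holderConjugate_iff]
    refine ⟨(one_lt_inv₀ hp).2 (by have : 0 < 1 / q := by positivity
                                   linarith), ?_⟩
    rw [inv_inv, one_div]; ring
  refine (Real.inner_le_Lp_mul_Lq_of_nonneg (Finset.range m) hpq
    (fun i _ => Real.rpow_nonneg (hd i) _) (fun i _ => Real.rpow_nonneg (hc i) _)).trans ?_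
  have e1 : ∀ i, (((t (i + 1) : ℝ) - t i) ^ (1 - 1 / q)) ^ (1 - 1 / q)⁻¹ =
      (t (i + 1) : ℝ) - t i := fun i => Real.rpow_rpow_inv (hd i) hp.ne'
  have e2 : ∀ i, (control q g (t i) (t (i + 1)) ^ (1 / q)) ^ q =
      control q g (t i) (t (i + 1)) := fun i => by
    rw [one_div]; exact Real.rpow_inv_rpow (hc i) hq0.ne'
  simp only [e1, e2]
  rw [one_div (1 - 1 / q)⁻¹, inv_inv, Finset.sum_range_sub (fun i => (t i : ℝ))]
  have h1 : (t m : ℝ) - t 0 ≤ b - a := by linarith [(t 0).2.1, (t m).2.2]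
  have h2 : (0 : ℝ) ≤ t m - t 0 := sub_nonneg.2 (ht (Nat.zero_le m))
  have h3 : ∑ i ∈ Finset.range m, control q g (t i) (t (i + 1)) ≤ V :=
    (sum_control_le hV ht m).trans (control_le hV _ _)
  have h4 := Finset.sum_nonneg fun i (_ : i ∈ Finset.range m) => hc i
  gcongr

end Young

/-! ### Partitions, refinement and existence of the integral -/

section Partitions

variable {a b : ℝ}

/-- Repeated points contribute nothing and can be deleted, so the bound for strictly increasing
sequences passes to monotone ones. -/
lemma varSum_le_of_pVariation_lt_top {q : ℝ} (hq : 0 < q) {g : Set.Icc a b → ℝ}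
    (hg : pVariation q g < ∞) (n : ℕ) (u : ℕ → Set.Icc a b) (hu : Monotone u) :
    varSum q g u n ≤ (pVariation q g).toReal ^ q := by
  induction n generalizing u with
  | zero => simp only [varSum, Finset.range_zero, Finset.sum_empty]; positivity
  | succ n ih =>
    by_cases h : ∃ i < n + 1, u i = u (i + 1)
    · obtain ⟨i, hi, hui⟩ := h
      rcases i with _ | j
      · have h1 : varSum q g u (n + 1) = varSum q g (fun i => u (i + 1)) n := by
          rw [varSum, Finset.sum_range_succ', ← hui, sub_self, abs_zero, Real.zero_rpow hq.ne',
            add_zero, varSum]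
        rw [h1]
        exact ih _ fun i j hij => hu (by lia)
      · have h1 : varSum q g u (n + 1) = varSum q g (skip u (j + 1)) n := by
          rw [varSum, sum_skip (fun x y => |g y - g x| ^ q) u (by lia : j < n), varSum]
          simp only [← hui]
          simp [Real.zero_rpow hq.ne']
        rw [h1]
        exact ih _ (monotone_skip hu _)
    · push Not at h
      set t : Fin (n + 1 + 1) → Set.Icc a b := fun i => u i with ht
      have hts : StrictMono t := by
        refine Fin.strictMono_iff_lt_succ.2 fun i => ?_
        simp only [ht, Fin.val_castSucc, Fin.val_succ]
        exact lt_of_le_of_ne (hu (Nat.le_succ _)) (h i i.2)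
      have h1 : ENNReal.ofReal ((∑ i : Fin (n + 1), |g (t i.succ) - g (t i.castSucc)| ^ q) ^
          (1 / q)) ≤ pVariation q g :=
        le_iSup_of_le (n + 1) (le_iSup_of_le t (le_iSup_of_le hts le_rfl))
      have h2 : varSum q g u (n + 1) =
          ∑ i : Fin (n + 1), |g (t i.succ) - g (t i.castSucc)| ^ q := by
        rw [varSum, Finset.sum_range]; rfl
      have h3 := ENNReal.toReal_mono hg.ne h1
      have h0 := varSum_nonneg q g u (n + 1)
      rw [← h2, ENNReal.toReal_ofReal (by positivity)] at h3
      have h4 := Real.rpow_le_rpow (by positivity) h3 hq.le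
      rwa [← Real.rpow_mul h0, one_div_mul_cancel hq.ne', Real.rpow_one] at h4

namespace Partition

/-- The points of a partition as a sequence, constant after the last point. -/
def seq (P : Partition a b) (i : ℕ) : Set.Icc a b := P.t ⟨min i P.m, by lia⟩

lemma monotone_seq (P : Partition a b) : Monotone P.seq := fun i j hij =>
  P.strictMono.monotone (by rw [Fin.mk_le_mk]; lia)

lemma seq_castSucc (P : Partition a b) (i : Fin P.m) : P.seq i = P.t i.castSucc := by
  unfold seq; congr 1; ext; simp

lemma seq_succ (P : Partition a b) (i : Fin P.m) : P.seq (i + 1) = P.t i.succ := by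
  unfold seq; congr 1; ext; simp

lemma seq_zero (P : Partition a b) : P.seq 0 = P.t 0 := by
  unfold seq; congr 1

lemma seq_m (P : Partition a b) : P.seq P.m = P.t (Fin.last P.m) := by
  unfold seq; congr 1; ext; simp

lemma sum_eq_seqSum (f g : Set.Icc a b → ℝ) (P : Partition a b) :
    P.sum f g = seqSum f g P.seq P.m := by
  rw [seqSum, Finset.sum_range, Partition.sum]
  exact Finset.sum_congr rfl fun i _ => by rw [seq_castSucc, seq_succ]

lemma seq_sub_le_mesh (P : Partition a b) {i : ℕ} (hi : i < P.m) :
    (P.seq (i + 1) : ℝ) - P.seq i ≤ P.mesh := by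
  have := le_ciSup (f := fun i : Fin P.m => (P.t i.succ : ℝ) - (P.t i.castSucc : ℝ))
    (Set.finite_range _).bddAbove ⟨i, hi⟩
  rwa [← seq_castSucc, ← seq_succ] at this

lemma mesh_nonneg (P : Partition a b) : 0 ≤ P.mesh :=
  Real.iSup_nonneg fun _ => sub_nonneg.2 (P.strictMono.monotone (Fin.castSucc_lt_succ).le)

/-- `u` enumerates the union of the two sets of points in increasing order, and `k`, `l` give the
positions of the points of `P` and `Q` in it. -/
lemma exists_common_refinement (P Q : Partition a b) :
    ∃ (u : ℕ → Set.Icc a b) (k l : ℕ → ℕ), Monotone u ∧ Monotone k ∧ Monotone l ∧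
      u ∘ k = P.seq ∧ u ∘ l = Q.seq ∧ k 0 = l 0 ∧ k P.m = l Q.m := by
  classical
  set F : Finset (Set.Icc a b) := Finset.univ.image P.t ∪ Finset.univ.image Q.t with hF
  have hP : ∀ i, P.seq i ∈ F := fun i =>
    Finset.mem_union_left _ (Finset.mem_image_of_mem _ (Finset.mem_univ _))
  have hQ : ∀ i, Q.seq i ∈ F := fun i =>
    Finset.mem_union_right _ (Finset.mem_image_of_mem _ (Finset.mem_univ _))
  have hpos : 0 < F.card := Finset.card_pos.2 ⟨_, hP 0⟩
  set e := F.orderIsoOfFin rfl with he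
  refine ⟨fun j => e ⟨min j (F.card - 1), by lia⟩, fun i => e.symm ⟨P.seq i, hP i⟩,
    fun i => e.symm ⟨Q.seq i, hQ i⟩, ?_, ?_, ?_, ?_, ?_, ?_, ?_⟩
  · intro i j hij
    exact e.monotone (by rw [Fin.mk_le_mk]; lia)
  · intro i j hij
    exact e.symm.monotone (P.monotone_seq hij)
  · intro i j hij
    exact e.symm.monotone (Q.monotone_seq hij)
  · funext i
    simp only [Function.comp_apply]
    have : (⟨min (e.symm ⟨P.seq i, hP i⟩ : ℕ) (F.card - 1), by lia⟩ : Fin F.card) =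
        e.symm ⟨P.seq i, hP i⟩ := by ext; simp; lia
    rw [this, OrderIso.apply_symm_apply]
  · funext i
    simp only [Function.comp_apply]
    have : (⟨min (e.symm ⟨Q.seq i, hQ i⟩ : ℕ) (F.card - 1), by lia⟩ : Fin F.card) =
        e.symm ⟨Q.seq i, hQ i⟩ := by ext; simp; lia
    rw [this, OrderIso.apply_symm_apply]
  · have : P.seq 0 = Q.seq 0 := Subtype.ext (by rw [seq_zero, seq_zero, P.first, Q.first])
    simp only [this]
  · have : P.seq P.m = Q.seq Q.m := Subtype.ext (by rw [seq_m, seq_m, P.last, Q.last])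
    simp only [this]

lemma uniform_mem (hab : a < b) (N : ℕ) (i : Fin (N + 1 + 1)) :
    a + (b - a) * ((i : ℕ) / (N + 1)) ∈ Set.Icc a b := by
  have h1 : 0 ≤ b - a := by linarith
  have h2 : ((i : ℕ) : ℝ) / (N + 1) ≤ 1 := by
    rw [div_le_one (by positivity)]
    exact_mod_cast (by lia : (i : ℕ) ≤ N + 1)
  have h3 : 0 ≤ (b - a) * (((i : ℕ) : ℝ) / (N + 1)) := by positivity
  exact ⟨by linarith, by nlinarith⟩

/-- The partition of `[a, b]` into `N + 1` intervals of the same length. -/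
def uniform (hab : a < b) (N : ℕ) : Partition a b where
  m := N + 1
  t i := ⟨a + (b - a) * ((i : ℕ) / (N + 1)), uniform_mem hab N i⟩
  strictMono i j hij := by
    have h1 : 0 < b - a := by linarith
    have h2 : ((i : ℕ) : ℝ) < (j : ℕ) := by exact_mod_cast hij
    refine Subtype.mk_lt_mk.2 ?_
    gcongr
  first := by simp
  last := by
    simp only [Fin.val_last]
    push_cast
    rw [div_self (by positivity)]
    ring

lemma uniform_seq (hab : a < b) (N : ℕ) {i : ℕ} (hi : i ≤ N + 1) :
    ((uniform hab N).seq i : ℝ) = a + (b - a) * (i / (N + 1)) := by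
  simp only [seq, uniform]
  rw [min_eq_left hi]

lemma uniform_seq_sub (hab : a < b) (N : ℕ) {i : ℕ} (hi : i < N + 1) :
    ((uniform hab N).seq (i + 1) : ℝ) - (uniform hab N).seq i = (b - a) / (N + 1) := by
  rw [uniform_seq hab N hi, uniform_seq hab N hi.le]
  push_cast
  ring

lemma mesh_uniform (hab : a < b) (N : ℕ) : (uniform hab N).mesh = (b - a) / (N + 1) := by
  have h : ∀ i : Fin (uniform hab N).m, (((uniform hab N).t i.succ : ℝ) -
      ((uniform hab N).t i.castSucc : ℝ)) = (b - a) / (N + 1) := by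
    intro i
    rw [← seq_castSucc, ← seq_succ, uniform_seq_sub hab N i.2]
  have : Nonempty (Fin (uniform hab N).m) := ⟨⟨0, Nat.succ_pos N⟩⟩
  unfold mesh
  simp only [h, ciSup_const]

lemma tendsto_mesh_uniform (hab : a < b) :
    Tendsto (fun N => (uniform hab N).mesh) atTop (𝓝 0) := by
  simp only [mesh_uniform]
  have := (tendsto_one_div_add_atTop_nhds_zero_nat (𝕜 := ℝ)).const_mul (b - a)
  simpa [div_eq_mul_inv] using this

end Partition

lemma tendsto_uniform (hab : a < b) :
    Tendsto (Partition.uniform hab) atTop (comap Partition.mesh (𝓝 0)) :=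
  tendsto_comap_iff.2 (Partition.tendsto_mesh_uniform hab)

lemma neBot_comap_mesh (hab : a < b) : (comap (Partition.mesh (a := a) (b := b)) (𝓝 0)).NeBot :=
  (tendsto_uniform hab).neBot

lemma HasYoungIntegral.unique (hab : a < b) {f g : Set.Icc a b → ℝ} {L L' : ℝ}
    (h : HasYoungIntegral f g L) (h' : HasYoungIntegral f g L') : L = L' :=
  have := neBot_comap_mesh hab
  tendsto_nhds_unique h h'

/-- The data of Young integration: exponents `α` and `q` with `α + 1 / q > 1`, and a bound `V` for
the `q`-variation of `g`. -/
structure YoungData (α q V : ℝ) (g : Set.Icc a b → ℝ) : Prop where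
  lt : a < b
  one_lt : 1 < q
  lt_exp : 1 - 1 / q < α
  bound : ∀ (n : ℕ) (u : ℕ → Set.Icc a b), Monotone u → varSum q g u n ≤ V

/-- The constant in the error estimate for Riemann sums. -/
def errConst (a b α q V : ℝ) : ℝ :=
  youngConst (α + 1 / q) * ((b - a) ^ (1 - 1 / q) * V ^ (1 / q))

namespace YoungData

variable {α q V : ℝ} {g : Set.Icc a b → ℝ}

lemma exp_pos (d : YoungData α q V g) : 0 < α := by
  have h1 := d.one_lt
  have h2 := d.lt_exp
  have : 1 / q < 1 := by rw [div_lt_one (by linarith)]; exact h1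
  linarith

/-- Both sums are compared with the sum along the common refinement, which is the same for both
because the first and last indices agree. -/
lemma abs_sum_sub_sum_le (d : YoungData α q V g) {M : ℝ} (hM : 0 ≤ M) {f : Set.Icc a b → ℝ}
    (hf : IsHolder M α f) (P Q : Partition a b) :
    |P.sum f g - Q.sum f g| ≤ errConst a b α q V * M * P.mesh ^ (α - (1 - 1 / q)) +
      errConst a b α q V * M * Q.mesh ^ (α - (1 - 1 / q)) := by
  obtain ⟨u, k, l, hu, hk, hl, hP, hQ, h0, hm⟩ := P.exists_common_refinement Q
  have hθ : 1 < α + 1 / q := by linarith [d.lt_exp]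
  have hq : 0 < q := by linarith [d.one_lt]
  have hC : 0 ≤ youngConst (α + 1 / q) * M := mul_nonneg (youngConst_nonneg _) hM
  have key : ∀ (R : Partition a b) (r : ℕ → ℕ), Monotone r → u ∘ r = R.seq →
      |R.sum f g - (seqSum f g u (r R.m) - seqSum f g u (r 0))| ≤
        errConst a b α q V * M * R.mesh ^ (α - (1 - 1 / q)) := by
    intro R r hr hur
    have h1 := abs_seqSum_comp_sub_le hM d.exp_pos hq hθ hf d.bound u hu r hr R.m
    have h2 := sum_rpow_mul_control_le d.one_lt d.lt_exp.le d.bound R.seq R.monotone_seq R.m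
      R.mesh_nonneg fun i hi => R.seq_sub_le_mesh hi
    have h3 : ∀ i, u (r i) = R.seq i := fun i => congrFun hur i
    simp only [h3, hur] at h1
    rw [R.sum_eq_seqSum]
    refine h1.trans ((mul_le_mul_of_nonneg_left h2 hC).trans_eq ?_)
    unfold errConst
    ring
  have h1 := key P k hk hP
  have h2 := key Q l hl hQ
  rw [h0, hm] at h1
  rw [abs_sub_comm] at h2
  refine le_trans (le_of_eq ?_) ((abs_add_le _ _).trans (add_le_add h1 h2))
  congr 1
  ring

lemma tendsto_err (d : YoungData α q V g) (C : ℝ) :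
    Tendsto (fun P : Partition a b => C * P.mesh ^ (α - (1 - 1 / q)))
      (comap Partition.mesh (𝓝 0)) (𝓝 0) := by
  have hε : 0 < α - (1 - 1 / q) := sub_pos.2 d.lt_exp
  have h1 : Tendsto (fun x : ℝ => C * x ^ (α - (1 - 1 / q))) (𝓝 0) (𝓝 0) := by
    have := ((Real.continuousAt_rpow_const 0 _ (Or.inr hε.le)).tendsto).const_mul C
    rwa [Real.zero_rpow hε.ne', mul_zero] at this
  exact h1.comp tendsto_comap

lemma exists_hasYoungIntegral (d : YoungData α q V g) {M : ℝ} (hM : 0 ≤ M)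
    {f : Set.Icc a b → ℝ} (hf : IsHolder M α f) : ∃ L, HasYoungIntegral f g L := by
  have := neBot_comap_mesh d.lt
  refine cauchy_map_iff_exists_tendsto.1 (Metric.cauchy_iff.2 ⟨inferInstance, fun ε hε => ?_⟩)
  have h1 := (d.tendsto_err (errConst a b α q V * M)).eventually_lt_const (half_pos hε)
  refine ⟨_, image_mem_map h1, ?_⟩
  rintro _ ⟨P, hP, rfl⟩ _ ⟨Q, hQ, rfl⟩
  have := d.abs_sum_sub_sum_le hM hf P Q
  simp only [Set.mem_ofPred_eq] at hP hQ
  rw [Real.dist_eq]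
  linarith

lemma abs_sum_sub_le (d : YoungData α q V g) {M : ℝ} (hM : 0 ≤ M) {f : Set.Icc a b → ℝ}
    (hf : IsHolder M α f) {L : ℝ} (hL : HasYoungIntegral f g L) (P : Partition a b) :
    |P.sum f g - L| ≤ errConst a b α q V * M * P.mesh ^ (α - (1 - 1 / q)) := by
  have := neBot_comap_mesh d.lt
  have h1 : Tendsto (fun Q : Partition a b => |P.sum f g - Q.sum f g|)
      (comap Partition.mesh (𝓝 0)) (𝓝 |P.sum f g - L|) := (tendsto_const_nhds.sub hL).abs
  have h2 := (d.tendsto_err (errConst a b α q V * M)).const_add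
    (errConst a b α q V * M * P.mesh ^ (α - (1 - 1 / q)))
  rw [add_zero] at h2
  exact le_of_tendsto_of_tendsto' h1 h2 fun Q => d.abs_sum_sub_sum_le hM hf P Q

end YoungData

end Partitions

/-! ### Linearity, continuity and maximisers of the integral -/

section Linear

variable {a b : ℝ}

lemma IsHolder.of_holderSeminorm_le {M α : ℝ} (hM : 0 ≤ M) {f : Set.Icc a b → ℝ}
    (h : holderSeminorm α f ≤ ENNReal.ofReal M) : IsHolder M α f := by
  intro s t
  rcases eq_or_ne s t with rfl | hst
  · rw [sub_self, abs_zero]; positivity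
  · have h1 : ENNReal.ofReal (|f t - f s| / |(t : ℝ) - (s : ℝ)| ^ α) ≤ ENNReal.ofReal M :=
      le_trans (le_iSup_of_le s (le_iSup_of_le t (le_iSup_of_le
        (f := fun _ : s ≠ t => ENNReal.ofReal (|f t - f s| / |(t : ℝ) - (s : ℝ)| ^ α)) hst le_rfl))) h
    have h2 : 0 < |(t : ℝ) - (s : ℝ)| :=
      abs_pos.2 (sub_ne_zero.2 fun h => hst (Subtype.ext h.symm))
    rwa [ENNReal.ofReal_le_ofReal_iff hM, div_le_iff₀ (by positivity)] at h1

lemma IsHolder.holderSeminorm_le {M α : ℝ} {f : Set.Icc a b → ℝ} (h : IsHolder M α f) :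
    holderSeminorm α f ≤ ENNReal.ofReal M := by
  refine iSup_le fun s => iSup_le fun t => iSup_le fun hst => ENNReal.ofReal_le_ofReal ?_
  have h2 : 0 < |(t : ℝ) - (s : ℝ)| :=
    abs_pos.2 (sub_ne_zero.2 fun h => hst (Subtype.ext h.symm))
  rw [div_le_iff₀ (by positivity)]
  exact h s t

lemma exists_isHolder_of_lt_top {α : ℝ} {f : Set.Icc a b → ℝ} (h : holderSeminorm α f < ∞) :
    ∃ M, 0 ≤ M ∧ IsHolder M α f :=
  ⟨_, ENNReal.toReal_nonneg, .of_holderSeminorm_le ENNReal.toReal_nonneg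
    (ENNReal.ofReal_toReal h.ne).ge⟩

lemma IsHolder.mono {M M' α : ℝ} {f : Set.Icc a b → ℝ} (h : IsHolder M α f) (hM : M ≤ M') :
    IsHolder M' α f := fun s t =>
  (h s t).trans (mul_le_mul_of_nonneg_right hM (by positivity))

lemma IsHolder.add {M M' α : ℝ} {f f' : Set.Icc a b → ℝ} (h : IsHolder M α f)
    (h' : IsHolder M' α f') : IsHolder (M + M') α (f + f') := fun s t => by
  rw [add_mul]
  refine le_trans (le_of_eq ?_) ((abs_add_le _ _).trans (add_le_add (h s t) (h' s t)))
  simp only [Pi.add_apply]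
  ring_nf

lemma IsHolder.const_smul {M α : ℝ} {f : Set.Icc a b → ℝ} (h : IsHolder M α f) (r : ℝ) :
    IsHolder (|r| * M) α (r • f) := fun s t => by
  simp only [Pi.smul_apply, smul_eq_mul]
  rw [← mul_sub, abs_mul, mul_assoc]
  exact mul_le_mul_of_nonneg_left (h s t) (abs_nonneg r)

lemma IsHolder.sub_const {M α : ℝ} {f : Set.Icc a b → ℝ} (h : IsHolder M α f) (r : ℝ) :
    IsHolder M α (fun x => f x - r) := fun s t => by
  rw [sub_sub_sub_cancel_right]; exact h s t

lemma isHolder_zero (α : ℝ) : IsHolder 0 α (0 : Set.Icc a b → ℝ) := fun s t => by simp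

lemma HasYoungIntegral.add {f f' g : Set.Icc a b → ℝ} {L L' : ℝ} (h : HasYoungIntegral f g L)
    (h' : HasYoungIntegral f' g L') : HasYoungIntegral (f + f') g (L + L') := by
  refine (Tendsto.add h h').congr fun P => ?_
  simp only [Partition.sum, ← Finset.sum_add_distrib, Pi.add_apply, add_mul]

lemma HasYoungIntegral.const_smul {f g : Set.Icc a b → ℝ} {L : ℝ} (h : HasYoungIntegral f g L)
    (r : ℝ) : HasYoungIntegral (r • f) g (r * L) := by
  refine (Tendsto.const_mul r h).congr fun P => ?_
  simp only [Partition.sum, Finset.mul_sum, Pi.smul_apply, smul_eq_mul, mul_assoc]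

lemma hasYoungIntegral_zero (g : Set.Icc a b → ℝ) : HasYoungIntegral 0 g 0 :=
  tendsto_const_nhds.congr fun P => by simp [Partition.sum]

/-- The increments of `g` telescope to `g b - g a = 0`; this is what makes semi-norm and norm balls
give the same values. -/
lemma Partition.sum_sub_const {f g : Set.Icc a b → ℝ} (hg : ∀ x y : Set.Icc a b, (x : ℝ) = a →
    (y : ℝ) = b → g x = g y) (r : ℝ) (P : Partition a b) :
    P.sum (fun x => f x - r) g = P.sum f g := by
  have h0 : g (P.seq 0) = g (P.seq P.m) :=
    hg _ _ (by rw [P.seq_zero, P.first]) (by rw [P.seq_m, P.last])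
  simp only [P.sum_eq_seqSum, seqSum, sub_mul, Finset.sum_sub_distrib]
  rw [← Finset.mul_sum, Finset.sum_range_sub (fun i => g (P.seq i)), h0, sub_self, mul_zero,
    sub_zero]

lemma HasYoungIntegral.sub_const {f g : Set.Icc a b → ℝ} {L : ℝ} (h : HasYoungIntegral f g L)
    (hg : ∀ x y : Set.Icc a b, (x : ℝ) = a → (y : ℝ) = b → g x = g y) (r : ℝ) :
    HasYoungIntegral (fun x => f x - r) g L :=
  Tendsto.congr (fun P => (P.sum_sub_const hg r).symm) h

namespace YoungData

variable {α q V : ℝ} {g : Set.Icc a b → ℝ}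

/-- The Young integral is continuous for pointwise convergence on Hölder balls. -/
lemma tendsto_of_tendsto_apply (d : YoungData α q V g) {M : ℝ} (hM : 0 ≤ M) {ι : Type*}
    {l : Filter ι} {F : ι → Set.Icc a b → ℝ} {f : Set.Icc a b → ℝ} {J : ι → ℝ} {L : ℝ}
    (hF : ∀ i, IsHolder M α (F i)) (hf : IsHolder M α f)
    (hJ : ∀ i, HasYoungIntegral (F i) g (J i)) (hL : HasYoungIntegral f g L)
    (hFf : ∀ x, Tendsto (fun i => F i x) l (𝓝 (f x))) : Tendsto J l (𝓝 L) := by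
  have := neBot_comap_mesh d.lt
  rw [Metric.tendsto_nhds]
  intro ε hε
  obtain ⟨P, hP⟩ := ((d.tendsto_err (errConst a b α q V * M)).eventually_lt_const
    (by positivity : 0 < ε / 3)).exists
  have hS : Tendsto (fun i => P.sum (F i) g) l (𝓝 (P.sum f g)) :=
    tendsto_finsetSum _ fun i _ => (hFf _).mul_const _
  filter_upwards [Metric.tendsto_nhds.1 hS (ε / 3) (by positivity)] with i hi
  have h1 := (d.abs_sum_sub_le hM (hF i) (hJ i) P).trans_lt hP
  have h2 := (d.abs_sum_sub_le hM hf hL P).trans_lt hP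
  rw [Real.dist_eq] at hi ⊢
  rw [abs_lt] at *
  constructor <;> linarith

/-- The Young integral attains its maximum over the functions of semi-norm at most one vanishing at
a given point. -/
lemma exists_isMaxOn (d : YoungData α q V g)
    (hg : ∀ x y : Set.Icc a b, (x : ℝ) = a → (y : ℝ) = b → g x = g y) (c : Set.Icc a b) :
    ∃ (f : Set.Icc a b → ℝ) (W : ℝ), f c = 0 ∧ IsHolder 1 α f ∧ HasYoungIntegral f g W ∧
      ∀ f' L, IsHolder 1 α f' → HasYoungIntegral f' g L → L ≤ W := by
  set K : Set (Set.Icc a b → ℝ) := {f | f c = 0 ∧ IsHolder 1 α f} with hK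
  have hKc : IsCompact K := by
    -- Tychonoff: the condition `f c = 0` confines each value `f t` to a compact interval, and the
    -- Hölder condition is closed for pointwise convergence.
    refine IsCompact.of_isClosed_subset (isCompact_univ_pi fun t : Set.Icc a b =>
      isCompact_Icc (a := -|(t : ℝ) - c| ^ α) (b := |(t : ℝ) - c| ^ α)) ?_ ?_
    · have : K = {f | f c = 0} ∩ ⋂ s : Set.Icc a b, ⋂ t : Set.Icc a b,
          {f | |f t - f s| ≤ 1 * |(t : ℝ) - s| ^ α} := by
        ext f; simp only [hK, IsHolder, Set.mem_inter_iff, Set.mem_iInter]; rfl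
      rw [this]
      refine (isClosed_eq (continuous_apply c) continuous_const).inter
        (isClosed_iInter fun s => isClosed_iInter fun t => isClosed_le ?_ continuous_const)
      exact ((continuous_apply t).sub (continuous_apply s)).abs
    · rintro f ⟨hfc, hf⟩ t -
      have := hf c t
      rwa [hfc, sub_zero, one_mul, abs_le] at this
  choose! J hJ using fun (f : Set.Icc a b → ℝ) (hf : f ∈ K) =>
    d.exists_hasYoungIntegral zero_le_one hf.2
  have hcont : ContinuousOn J K := by
    rw [continuousOn_iff_continuous_domRestrict, continuous_iff_continuousAt]
    intro f
    exact d.tendsto_of_tendsto_apply zero_le_one (F := fun f : K => (f : Set.Icc a b → ℝ))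
      (J := K.domRestrict J) (fun f => f.2.2) f.2.2 (fun f => hJ f f.2) (hJ f f.2)
      fun x => ((continuous_apply x).comp continuous_subtype_val).tendsto f
  have h0 : (0 : Set.Icc a b → ℝ) ∈ K := ⟨rfl, (isHolder_zero α).mono zero_le_one⟩
  obtain ⟨f, hfK, hf⟩ := hKc.exists_isMaxOn ⟨0, h0⟩ hcont
  refine ⟨f, J f, hfK.1, hfK.2, hJ f hfK, fun f' L hf' hL => ?_⟩
  have h1 : (fun x => f' x - f' c) ∈ K := ⟨sub_self _, hf'.sub_const _⟩
  rw [(hL.sub_const hg (f' c)).unique d.lt (hJ _ h1)]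
  exact hf h1

end YoungData

/-- `W` bounds the Young integral over the unit ball of the Hölder semi-norm. -/
lemma le_mul_of_isHolder {α W : ℝ} {g : Set.Icc a b → ℝ}
    (hW : ∀ f L, IsHolder 1 α f → HasYoungIntegral f g L → L ≤ W) {M : ℝ} (hM : 0 ≤ M)
    {f : Set.Icc a b → ℝ} (hf : IsHolder M α f) {L : ℝ} (hL : HasYoungIntegral f g L) :
    L ≤ W * M := by
  -- Rescaling needs a positive constant; letting `M'` decrease to `M` covers `M = 0`.
  have key : ∀ M' > 0, IsHolder M' α f → L ≤ W * M' := by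
    intro M' hM' hf'
    have h1 := hf'.const_smul M'⁻¹
    rw [abs_of_pos (inv_pos.2 hM'), inv_mul_cancel₀ hM'.ne'] at h1
    have h2 := hW _ _ h1 (hL.const_smul M'⁻¹)
    rwa [inv_mul_le_iff₀ hM', mul_comm] at h2
  have hlim : Tendsto (fun M' => W * M') (𝓝[>] M) (𝓝 (W * M)) :=
    ((continuous_const.mul continuous_id).tendsto M).mono_left nhdsWithin_le_nhds
  refine ge_of_tendsto hlim ?_
  filter_upwards [self_mem_nhdsWithin] with M' hM'
  exact key M' (hM.trans_lt hM') (hf.mono (le_of_lt hM'))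

end Linear

/-! ### Representation by measures and Lipschitz approximation -/

section Duality

open CompactlySupported in
/-- The Riesz–Markov–Kakutani theorem on a compact space. -/
lemma exists_measure_of_nonneg {X : Type*} [TopologicalSpace X] [CompactSpace X] [T2Space X]
    [MeasurableSpace X] [BorelSpace X] (Λ : C(X, ℝ) →ₗ[ℝ] ℝ) (hΛ : ∀ h, 0 ≤ h → 0 ≤ Λ h) :
    ∃ μ : Measure X, IsFiniteMeasure μ ∧ ∀ h : C(X, ℝ), ∫ x, h x ∂μ = Λ h := by
  let T : C_c(X, ℝ) →ₚ[ℝ] ℝ := PositiveLinearMap.mk₀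
    { toFun := fun h => Λ (h : C(X, ℝ))
      map_add' := fun h h' => by rw [← map_add]; rfl
      map_smul' := fun r h => by rw [← map_smul]; rfl } fun h hh => hΛ _ fun x => hh x
  refine ⟨RealRMK.rieszMeasure T, inferInstance, fun h => ?_⟩
  exact RealRMK.integral_rieszMeasure T (CompactlySupportedContinuousMap.continuousMapEquiv h)

/-- A functional bounded by the positive part of its argument is given by a positive measure. -/
lemma exists_measure_of_le {X : Type*} [TopologicalSpace X] [CompactSpace X] [T2Space X]
    [MeasurableSpace X] [BorelSpace X] {E : Type*} [AddCommGroup E] [Module ℝ E]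
    (Φ : E →ₗ[ℝ] C(X, ℝ)) (hΦ : Function.Injective Φ) (J : E →ₗ[ℝ] ℝ) {W : ℝ} (hW : 0 ≤ W)
    (hJ : ∀ f r, 0 ≤ r → (∀ x, Φ f x ≤ r) → J f ≤ W * r) :
    ∃ μ : Measure X, IsFiniteMeasure μ ∧ μ Set.univ ≤ ENNReal.ofReal W ∧
      ∀ f, ∫ x, Φ f x ∂μ = J f := by
  have hle : ∀ (h : C(X, ℝ)) x, h x ≤ ‖h ⊔ 0‖ := fun h x => by
    have := (h ⊔ 0).norm_coe_le_norm x
    rw [Real.norm_eq_abs, ContinuousMap.sup_apply, ContinuousMap.zero_apply] at this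
    exact (le_max_left _ _).trans ((le_abs_self _).trans this)
  -- The majorant sees only the positive part. It vanishes on non-positive functions, which forces
  -- the extension to be positive, and its value at `1` bounds the mass.
  have hex := exists_extension_of_le_sublinear
    (⟨LinearMap.range Φ, J ∘ₗ (LinearEquiv.ofInjective Φ hΦ).symm.toLinearMap⟩ :
      C(X, ℝ) →ₗ.[ℝ] ℝ) (fun h => W * ‖h ⊔ 0‖)
  specialize hex ?_ ?_ ?_
  · intro r hr h
    have h1 : (r • h) ⊔ 0 = r • (h ⊔ 0) := by
      ext x
      simp [mul_max_of_nonneg _ _ hr.le]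
    rw [h1, norm_smul, Real.norm_of_nonneg hr.le]
    ring
  · intro h h'
    rw [← mul_add]
    refine mul_le_mul_of_nonneg_left ?_ hW
    refine (ContinuousMap.norm_le _ (by positivity)).2 fun x => ?_
    rw [ContinuousMap.sup_apply, ContinuousMap.zero_apply, Real.norm_of_nonneg (le_max_right _ _)]
    exact max_le (add_le_add (hle h x) (hle h' x)) (by positivity)
  · rintro ⟨_, f, rfl⟩
    have h1 : (LinearEquiv.ofInjective Φ hΦ).symm ⟨Φ f, f, rfl⟩ = f := by
      rw [LinearEquiv.symm_apply_eq]
      rfl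
    change J ((LinearEquiv.ofInjective Φ hΦ).symm ⟨Φ f, f, rfl⟩) ≤ _
    rw [h1]
    exact hJ f _ (norm_nonneg _) fun x => hle _ x
  obtain ⟨Λ, hΛ, hΛW⟩ := hex
  have hpos : ∀ h, 0 ≤ h → 0 ≤ Λ h := by
    intro h hh
    have := hΛW (-h)
    rw [map_neg, sup_eq_right.2 (neg_nonpos.2 hh), norm_zero, mul_zero] at this
    linarith
  obtain ⟨μ, hμ, hμΛ⟩ := exists_measure_of_nonneg Λ hpos
  refine ⟨μ, hμ, ?_, fun f => ?_⟩
  · have h1 := hμΛ 1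
    simp only [ContinuousMap.one_apply, integral_const, smul_eq_mul, mul_one] at h1
    have h2 := hΛW 1
    have h3 : ‖(1 : C(X, ℝ)) ⊔ 0‖ ≤ 1 := by
      refine (ContinuousMap.norm_le _ zero_le_one).2 fun x => ?_
      simp
    rw [← ENNReal.ofReal_toReal (measure_ne_top μ Set.univ)]
    refine ENNReal.ofReal_le_ofReal ?_
    calc (μ Set.univ).toReal = Λ 1 := h1
      _ ≤ W * ‖(1 : C(X, ℝ)) ⊔ 0‖ := h2
      _ ≤ W := mul_le_of_le_one_right hW h3
  · rw [hμΛ]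
    refine (hΛ ⟨Φ f, f, rfl⟩).trans ?_
    change J ((LinearEquiv.ofInjective Φ hΦ).symm ⟨Φ f, f, rfl⟩) = J f
    congr 1
    rw [LinearEquiv.symm_apply_eq]
    rfl

variable {a b : ℝ}

lemma IsHolder.continuous {M α : ℝ} (hα : 0 < α) {f : Set.Icc a b → ℝ} (hf : IsHolder M α f) :
    Continuous f := by
  rw [continuous_iff_continuousAt]
  intro s
  rw [ContinuousAt, tendsto_iff_dist_tendsto_zero]
  refine squeeze_zero (fun _ => dist_nonneg) (fun t => hf s t) ?_
  have h1 : Continuous fun t : Set.Icc a b => M * |(t : ℝ) - s| ^ α :=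
    continuous_const.mul ((by fun_prop : Continuous fun t : Set.Icc a b =>
      |(t : ℝ) - s|).rpow_const fun _ => Or.inr hα.le)
  have := h1.tendsto s
  simpa [Real.zero_rpow hα.ne'] using this

/-- The difference quotient of exponent `α`, equal to zero on the diagonal. -/
def diffQuot (α : ℝ) (f : Set.Icc a b → ℝ) (x : Set.Icc a b × Set.Icc a b) : ℝ :=
  |(x.2 : ℝ) - x.1| ^ (-α) * (f x.2 - f x.1)

lemma rpow_mul_diffQuot (α : ℝ) (f : Set.Icc a b → ℝ) (s t : Set.Icc a b) :
    |(t : ℝ) - s| ^ α * diffQuot α f (s, t) = f t - f s := by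
  rcases eq_or_ne s t with rfl | hst
  · simp [diffQuot]
  · have h2 : 0 < |(t : ℝ) - s| := abs_pos.2 (sub_ne_zero.2 fun h => hst (Subtype.ext h.symm))
    rw [diffQuot, ← mul_assoc, ← Real.rpow_add h2, add_neg_cancel, Real.rpow_zero, one_mul]

lemma IsHolder.abs_diffQuot_le {M α : ℝ} (hM : 0 ≤ M) {f : Set.Icc a b → ℝ}
    (hf : IsHolder M α f) (x : Set.Icc a b × Set.Icc a b) : |diffQuot α f x| ≤ M := by
  rcases eq_or_ne x.1 x.2 with h | h
  · simpa [diffQuot, h] using hM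
  · have h2 : 0 < |(x.2 : ℝ) - x.1| :=
      abs_pos.2 (sub_ne_zero.2 fun h' => h (Subtype.ext h'.symm))
    rw [diffQuot, abs_mul, abs_of_nonneg (by positivity), Real.rpow_neg h2.le,
      inv_mul_le_iff₀ (by positivity), mul_comm]
    exact hf _ _

/-- The quotient is bounded by `M * |t - s| ^ (1 - α)`, which tends to zero at the diagonal exactly
because `α < 1`. -/
lemma continuous_diffQuot {M α : ℝ} (hM : 0 ≤ M) (hα1 : α < 1) {f : Set.Icc a b → ℝ}
    (hf : IsHolder M 1 f) : Continuous (diffQuot α f) := by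
  have hfc := hf.continuous one_pos
  have hd : Continuous fun x : Set.Icc a b × Set.Icc a b => |(x.2 : ℝ) - x.1| := by fun_prop
  rw [continuous_iff_continuousAt]
  intro x
  rcases eq_or_ne x.1 x.2 with h | h
  · have h0 : diffQuot α f x = 0 := by simp [diffQuot, h]
    rw [ContinuousAt, h0]
    have h1 : Continuous fun x : Set.Icc a b × Set.Icc a b => M * |(x.2 : ℝ) - x.1| ^ (1 - α) :=
      continuous_const.mul (hd.rpow_const fun _ => Or.inr (by linarith))
    have h2 := h1.tendsto x
    rw [h, sub_self, abs_zero, Real.zero_rpow (by linarith), mul_zero] at h2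
    refine squeeze_zero_norm (fun y => ?_) h2
    rcases eq_or_ne y.1 y.2 with hy | hy
    · simp only [diffQuot, hy, sub_self, mul_zero, norm_zero]
      positivity
    · have h3 : 0 < |(y.2 : ℝ) - y.1| :=
        abs_pos.2 (sub_ne_zero.2 fun h' => hy (Subtype.ext h'.symm))
      rw [diffQuot, Real.norm_eq_abs, abs_mul, abs_of_nonneg (by positivity),
        show 1 - α = -α + 1 by ring, Real.rpow_add h3, mul_left_comm]
      exact mul_le_mul_of_nonneg_left (hf _ _) (by positivity)
  · refine ContinuousAt.mul (hd.continuousAt.rpow_const (Or.inl ?_)) (by fun_prop)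
    exact abs_ne_zero.2 (sub_ne_zero.2 fun h' => h (Subtype.ext h'.symm))

lemma IsHolder.of_lipschitz {M α : ℝ} (hM : 0 ≤ M) (hα : 0 < α) (hα1 : α ≤ 1)
    {f : Set.Icc a b → ℝ} (hf : IsHolder M 1 f) : IsHolder (M * (b - a) ^ (1 - α)) α f := by
  intro s t
  refine (hf s t).trans ?_
  have h1 : |(t : ℝ) - s| ≤ b - a := by
    rw [abs_le]; constructor <;> linarith [s.2.1, s.2.2, t.2.1, t.2.2]
  rw [mul_assoc]
  refine mul_le_mul_of_nonneg_left ?_ hM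
  have h2 : |(t : ℝ) - s| ^ (1 : ℝ) = |(t : ℝ) - s| ^ (1 - α) * |(t : ℝ) - s| ^ α := by
    rw [← Real.rpow_add_of_nonneg (abs_nonneg _) (by linarith) hα.le, sub_add_cancel]
  rw [h2]
  have : 0 ≤ 1 - α := by linarith
  gcongr

/-- A Hölder function is a pointwise limit of Lipschitz functions with the same Hölder constant. -/
lemma IsHolder.exists_lipschitz_approx (hab : a ≤ b) {M α : ℝ} (hM : 0 ≤ M) (hα : 0 < α)
    {f : Set.Icc a b → ℝ} (hf : IsHolder M α f) :
    ∃ F : ℕ → Set.Icc a b → ℝ, (∀ n, IsHolder M α (F n)) ∧ (∀ n : ℕ, IsHolder n 1 (F n)) ∧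
      ∀ x, Tendsto (fun n => F n x) atTop (𝓝 (f x)) := by
  have : Nonempty (Set.Icc a b) := ⟨⟨a, le_rfl, hab⟩⟩
  have hdist : ∀ s t : Set.Icc a b, |(t : ℝ) - s| ≤ b - a := fun s t => by
    rw [abs_le]; constructor <;> linarith [s.2.1, s.2.2, t.2.1, t.2.2]
  have hba : 0 ≤ b - a := sub_nonneg.2 hab
  have hlow : ∀ s t : Set.Icc a b, f t - M * (b - a) ^ α ≤ f s := fun s t => by
    have h1 := (abs_le.1 (hf s t)).2
    have h2 := mul_le_mul_of_nonneg_left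
      (Real.rpow_le_rpow (abs_nonneg _) (hdist s t) hα.le) hM
    linarith
  -- Infimal convolution with `n * |·|`.
  set F : ℕ → Set.Icc a b → ℝ := fun n t => ⨅ s : Set.Icc a b, (f s + n * |(t : ℝ) - s|) with hF
  have hbdd : ∀ (n : ℕ) (t : Set.Icc a b),
      BddBelow (Set.range fun s : Set.Icc a b => f s + n * |(t : ℝ) - s|) := by
    rintro n t
    refine ⟨f t - M * (b - a) ^ α, ?_⟩
    rintro _ ⟨s, rfl⟩
    have : 0 ≤ (n : ℝ) * |(t : ℝ) - s| := by positivity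
    dsimp only
    linarith [hlow s t]
  have hle : ∀ (n : ℕ) (t s : Set.Icc a b), F n t ≤ f s + n * |(t : ℝ) - s| := fun n t s =>
    ciInf_le (hbdd n t) s
  have hsymm : ∀ {C β : ℝ} {h : Set.Icc a b → ℝ},
      (∀ s t : Set.Icc a b, h t - h s ≤ C * |(t : ℝ) - s| ^ β) → IsHolder C β h := by
    intro C β h hh s t
    have h1 := hh t s
    rw [abs_sub_comm] at h1
    exact abs_le.2 ⟨by linarith, hh s t⟩
  refine ⟨F, fun n => hsymm fun t t' => ?_, fun n => hsymm fun t t' => ?_, fun t => ?_⟩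
  · rw [sub_le_comm]
    refine le_ciInf fun s => ?_
    -- The competitor `s` for `t` is translated along with `t` to one for `t'`, then clamped to `[a,
    -- b]`. Projection does not increase distances, so the penalty does not grow and `f` changes by
    -- at most `M * |t' - t| ^ α`.
    set s' : Set.Icc a b := Set.projIcc a b hab (s + (t' - t)) with hs'
    have h1 : |(s' : ℝ) - s| ≤ |(t' : ℝ) - t| := by
      have := Set.abs_projIcc_sub_projIcc hab (c := (s : ℝ) + (t' - t)) (d := s)
      rw [Set.projIcc_val] at this
      refine this.trans_eq ?_
      congr 1; ring
    have h2 : |(t' : ℝ) - s'| ≤ |(t : ℝ) - s| := by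
      have := Set.abs_projIcc_sub_projIcc hab (c := (t' : ℝ)) (d := (s : ℝ) + (t' - t))
      rw [Set.projIcc_val] at this
      refine this.trans_eq ?_
      congr 1; ring
    have h3 := (abs_le.1 (hf s s')).2
    have h4 := mul_le_mul_of_nonneg_left (Real.rpow_le_rpow (abs_nonneg _) h1 hα.le) hM
    have h5 := mul_le_mul_of_nonneg_left h2 (Nat.cast_nonneg (α := ℝ) n)
    linarith [hle n t' s']
  · rw [sub_le_comm]
    refine le_ciInf fun s => ?_
    have h1 : |(t' : ℝ) - s| ≤ |(t' : ℝ) - t| + |(t : ℝ) - s| := abs_sub_le _ _ _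
    have h2 := mul_le_mul_of_nonneg_left h1 (Nat.cast_nonneg (α := ℝ) n)
    rw [Real.rpow_one]
    linarith [hle n t' s]
  · rw [Metric.tendsto_atTop]
    intro ε hε
    have hc : Tendsto (fun x : ℝ => M * x ^ α) (𝓝 0) (𝓝 0) := by
      have := ((Real.continuousAt_rpow_const 0 α (Or.inr hα.le)).tendsto).const_mul M
      rwa [Real.zero_rpow hα.ne', mul_zero] at this
    obtain ⟨δ, hδ, hδε⟩ := Metric.tendsto_nhds_nhds.1 hc (ε / 2) (half_pos hε)
    -- From `N` on, the penalty at distance at least `δ` exceeds or equals the bound for the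
    -- oscillation of `f`, so only nearby points matter.
    obtain ⟨N, hN⟩ := exists_nat_ge (M * (b - a) ^ α / δ)
    refine ⟨N, fun n hn => ?_⟩
    have hup : F n t ≤ f t := by simpa using hle n t t
    have hdown : f t - ε / 2 ≤ F n t := by
      refine le_ciInf fun s => ?_
      rcases lt_or_ge |(t : ℝ) - s| δ with h | h
      · have h1 := hδε (x := |(t : ℝ) - s|) (by simpa using h)
        rw [dist_zero_right, Real.norm_eq_abs] at h1
        have h2 := (le_abs_self _).trans h1.le
        have h3 := (abs_le.1 (hf s t)).2
        have : 0 ≤ (n : ℝ) * |(t : ℝ) - s| := by positivity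
        linarith
      · have h1 : M * (b - a) ^ α ≤ N * δ := (div_le_iff₀ hδ).1 hN
        have h2 : (N : ℝ) * δ ≤ n * |(t : ℝ) - s| := by gcongr
        linarith [hlow s t]
    rw [Real.dist_eq, abs_lt]
    constructor <;> linarith

end Duality

/-! ### The coupling for `α < 1`, by duality -/

section Subcritical

variable {a b α q V : ℝ} {g : Set.Icc a b → ℝ}

/-- The Lipschitz functions on `[a, b]` vanishing at `c`. -/
def lipSubmodule (c : Set.Icc a b) : Submodule ℝ (Set.Icc a b → ℝ) where
  carrier := {f | f c = 0 ∧ ∃ M, 0 ≤ M ∧ IsHolder M 1 f}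
  zero_mem' := ⟨rfl, 0, le_rfl, isHolder_zero 1⟩
  add_mem' := by
    rintro f f' ⟨h0, M, hM, h⟩ ⟨h0', M', hM', h'⟩
    exact ⟨by simp [h0, h0'], _, add_nonneg hM hM', h.add h'⟩
  smul_mem' := by
    rintro r f ⟨h0, M, hM, h⟩
    exact ⟨by simp [h0], _, by positivity, h.const_smul r⟩

/-- The difference quotient as a linear map from Lipschitz to continuous functions. -/
def diffQuotMap (hα1 : α < 1) (c : Set.Icc a b) :
    lipSubmodule c →ₗ[ℝ] C(Set.Icc a b × Set.Icc a b, ℝ) where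
  toFun f := ⟨diffQuot α f, by
    obtain ⟨M, hM, h⟩ := f.2.2
    exact continuous_diffQuot hM hα1 h⟩
  map_add' f f' := by
    ext x
    simp only [diffQuot, Submodule.coe_add, Pi.add_apply, ContinuousMap.coe_mk,
      ContinuousMap.add_apply]
    ring
  map_smul' r f := by
    ext x
    simp only [diffQuot, Submodule.coe_smul, Pi.smul_apply, ContinuousMap.coe_mk,
      ContinuousMap.smul_apply, smul_eq_mul, RingHom.id_apply]
    ring

/-- Vanishing at `c` removes the constants; injectivity lets the integral be viewed as a functional
of the difference quotient. -/
lemma injective_diffQuotMap (hα1 : α < 1) (c : Set.Icc a b) :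
    Function.Injective (diffQuotMap hα1 c) := by
  rw [injective_iff_map_eq_zero]
  intro f hf
  ext t
  have h1 : diffQuot α f (c, t) = 0 := DFunLike.congr_fun hf (c, t)
  have h2 := rpow_mul_diffQuot α f c t
  rw [h1, mul_zero, f.2.1, sub_zero] at h2
  exact h2.symm

lemma YoungData.exists_coupling_of_lt_one (d : YoungData α q V g)
    (hg : ∀ x y : Set.Icc a b, (x : ℝ) = a → (y : ℝ) = b → g x = g y) (hα1 : α < 1) {W : ℝ}
    (hW : ∀ f L, IsHolder 1 α f → HasYoungIntegral f g L → L ≤ W) :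
    ∃ π ∈ couplings α g, energy α π ≤ ENNReal.ofReal W := by
  set c : Set.Icc a b := ⟨a, le_rfl, d.lt.le⟩
  have hα := d.exp_pos
  have hW0 : 0 ≤ W := hW 0 0 ((isHolder_zero α).mono zero_le_one) (hasYoungIntegral_zero g)
  have hba : 0 ≤ b - a := by linarith [d.lt]
  have hlip : ∀ {M : ℝ} {f : Set.Icc a b → ℝ}, 0 ≤ M → IsHolder M 1 f →
      ∃ L, HasYoungIntegral f g L := fun hM h =>
    d.exists_hasYoungIntegral (by positivity) (h.of_lipschitz hM hα hα1.le)
  choose J hJ using fun f : lipSubmodule c => hlip f.2.2.choose_spec.1 f.2.2.choose_spec.2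
  let Jl : lipSubmodule c →ₗ[ℝ] ℝ :=
    { toFun := J
      map_add' := fun f f' => (hJ _).unique d.lt ((hJ f).add (hJ f'))
      map_smul' := fun r f => (hJ _).unique d.lt ((hJ f).const_smul r) }
  obtain ⟨μ, hμ, hμW, hμJ⟩ := exists_measure_of_le (diffQuotMap hα1 c) (injective_diffQuotMap hα1 c)
    Jl hW0 fun f r hr hfr => by
      refine le_mul_of_isHolder hW hr (fun s t => ?_) (hJ f)
      -- A one-sided bound on the quotient suffices, since exchanging `s` and `t` changes its sign.
      have key : ∀ s t : Set.Icc a b, (f : Set.Icc a b → ℝ) t - (f : Set.Icc a b → ℝ) s ≤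
          r * |(t : ℝ) - s| ^ α := fun s t => by
        rw [← rpow_mul_diffQuot α, mul_comm]
        exact mul_le_mul_of_nonneg_right (hfr (s, t)) (by positivity)
      have h1 := key t s
      rw [abs_sub_comm] at h1
      exact abs_le.2 ⟨by linarith, key s t⟩
  have hd : Measurable fun x : Set.Icc a b × Set.Icc a b => |(x.2 : ℝ) - x.1| := by fun_prop
  have hdens : Measurable fun x : Set.Icc a b × Set.Icc a b =>
      ENNReal.ofReal (|(x.2 : ℝ) - x.1| ^ (-α)) := (hd.pow_const _).ennreal_ofReal
  -- On the diagonal `0 ^ (-α) = 0`, so `π` discards the mass of `μ` there, where difference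
  -- quotients vanish anyway.
  set π := μ.withDensity fun x => ENNReal.ofReal (|(x.2 : ℝ) - x.1| ^ (-α)) with hπ
  have henergy : energy α π ≤ ENNReal.ofReal W := by
    refine le_trans ?_ hμW
    rw [energy, hπ, lintegral_withDensity_eq_lintegral_mul _ hdens (hd.pow_const _).ennreal_ofReal,
      ← lintegral_one]
    refine lintegral_mono fun x => ?_
    simp only [Pi.mul_apply]
    rw [← ENNReal.ofReal_mul (by positivity), ← ENNReal.ofReal_one]
    refine ENNReal.ofReal_le_ofReal ?_
    rcases (abs_nonneg ((x.2 : ℝ) - x.1)).eq_or_lt with h | h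
    · rw [← h, Real.zero_rpow hα.ne', mul_zero]; exact zero_le_one
    · rw [← Real.rpow_add h, neg_add_cancel, Real.rpow_zero]
  refine ⟨π, ⟨henergy.trans_lt ENNReal.ofReal_lt_top, fun f hf => ?_⟩, henergy⟩
  obtain ⟨M, hM, hfM⟩ := exists_isHolder_of_lt_top hf
  have hint : ∀ f : Set.Icc a b → ℝ, ∫ x, (f x.2 - f x.1) ∂π = ∫ x, diffQuot α f x ∂μ := by
    intro f
    rw [hπ, integral_withDensity_eq_integral_toReal_smul hdens
      (Eventually.of_forall fun _ => ENNReal.ofReal_lt_top)]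
    refine integral_congr_ae (Eventually.of_forall fun x => ?_)
    dsimp only
    rw [ENNReal.toReal_ofReal (by positivity), smul_eq_mul, diffQuot]
  rw [hint]
  -- Both sides pass to the limit along Lipschitz approximants: the Young integral by continuity on
  -- Hölder balls, the other by dominated convergence with bound `M`.
  obtain ⟨F, hFM, hFlip, hFlim⟩ := hfM.exists_lipschitz_approx d.lt.le hM hα
  have hFJ : ∀ n, HasYoungIntegral (F n) g (∫ x, diffQuot α (F n) x ∂μ) := by
    intro n
    set f₀ : lipSubmodule c := ⟨fun x => F n x - F n c, sub_self _, n, Nat.cast_nonneg n,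
      (hFlip n).sub_const _⟩ with hf₀
    have h1 : ∫ x, diffQuot α (F n) x ∂μ = J f₀ := by
      refine Eq.trans ?_ (hμJ f₀)
      refine integral_congr_ae (Eventually.of_forall fun x => ?_)
      simp [diffQuotMap, diffQuot, hf₀]
    obtain ⟨L, hL⟩ := hlip (Nat.cast_nonneg n) (hFlip n)
    rw [h1, (hJ f₀).unique d.lt (hL.sub_const hg (F n c))]
    exact hL
  obtain ⟨L, hL⟩ := d.exists_hasYoungIntegral hM hfM
  have hlim1 := d.tendsto_of_tendsto_apply hM hFM hfM hFJ hL hFlim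
  have hlim2 : Tendsto (fun n => ∫ x, diffQuot α (F n) x ∂μ) atTop
      (𝓝 (∫ x, diffQuot α f x ∂μ)) := by
    refine tendsto_integral_of_dominated_convergence (fun _ => M) (fun n => ?_)
      (integrable_const M) (fun n => Eventually.of_forall fun x => (hFM n).abs_diffQuot_le hM x)
      (Eventually.of_forall fun x => ?_)
    · exact (continuous_diffQuot (Nat.cast_nonneg n) hα1 (hFlip n)).aestronglyMeasurable
    · exact ((hFlim x.2).sub (hFlim x.1)).const_mul _
  rwa [← tendsto_nhds_unique hlim1 hlim2]

end Subcritical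

/-! ### Dyadic layers of a non-negative function -/

section Dyadic

variable {a b : ℝ}

lemma sum_range_two_mul (F : ℕ → ℝ) (N : ℕ) :
    ∑ j ∈ Finset.range (2 * N), F j = ∑ j ∈ Finset.range N, (F (2 * j) + F (2 * j + 1)) := by
  induction N with
  | zero => simp
  | succ N ih =>
    rw [Finset.sum_range_succ, ← ih, mul_add, mul_one, Finset.sum_range_succ,
      Finset.sum_range_succ]
    ring

/-- The partition of `[a, b]` into `2 ^ n` intervals of the same length. -/
def dyadicPartition (hab : a < b) (n : ℕ) : Partition a b := Partition.uniform hab (2 ^ n - 1)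

/-- The dyadic points of `[a, b]`. -/
def dyadic (hab : a < b) (n j : ℕ) : Set.Icc a b := (dyadicPartition hab n).seq j

lemma dyadicPartition_m (hab : a < b) (n : ℕ) : (dyadicPartition hab n).m = 2 ^ n := by
  have : 0 < 2 ^ n := by positivity
  change 2 ^ n - 1 + 1 = 2 ^ n
  lia

lemma monotone_dyadic (hab : a < b) (n : ℕ) : Monotone (dyadic hab n) :=
  (dyadicPartition hab n).monotone_seq

lemma dyadic_coe (hab : a < b) (n j : ℕ) :
    (dyadic hab n j : ℝ) = a + (b - a) * ((min j (2 ^ n) : ℕ) / 2 ^ n) := by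
  have h1 : (2 ^ n - 1 + 1 : ℕ) = 2 ^ n := dyadicPartition_m hab n
  have h2 : (((2 ^ n - 1 : ℕ) : ℝ) + 1) = 2 ^ n := by exact_mod_cast h1
  change a + (b - a) * (((min j (2 ^ n - 1 + 1) : ℕ) : ℝ) / (((2 ^ n - 1 : ℕ) : ℝ) + 1)) = _
  rw [h1, h2]

lemma dyadic_succ_two_mul (hab : a < b) (n j : ℕ) :
    dyadic hab (n + 1) (2 * j) = dyadic hab n j := by
  apply Subtype.ext
  rw [dyadic_coe, dyadic_coe]
  have : min (2 * j) (2 ^ (n + 1)) = 2 * min j (2 ^ n) := by rw [pow_succ]; lia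
  rw [this, pow_succ]
  push_cast
  field_simp

lemma tendsto_dyadicPartition (hab : a < b) :
    Tendsto (dyadicPartition hab) atTop (comap Partition.mesh (𝓝 0)) :=
  (tendsto_uniform hab).comp (tendsto_atTop_mono (fun n => by
    have := Nat.lt_two_pow_self (n := n)
    lia : ∀ n : ℕ, n ≤ 2 ^ n - 1) tendsto_id)

variable (hab : a < b) (H : Set.Icc a b → ℝ)

/-- The infimum of `H` over a dyadic interval. -/
def lowInf (n j : ℕ) : ℝ :=
  ⨅ x : Set.Icc (dyadic hab n j) (dyadic hab n (j + 1)), H x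

variable {H}

lemma lowInf_le (hH : ∀ x, 0 ≤ H x) {n j : ℕ} {x : Set.Icc a b}
    (hx : x ∈ Set.Icc (dyadic hab n j) (dyadic hab n (j + 1))) : lowInf hab H n j ≤ H x :=
  ciInf_le (f := fun x : Set.Icc (dyadic hab n j) (dyadic hab n (j + 1)) => H x)
    ⟨0, by rintro _ ⟨x, rfl⟩; exact hH _⟩ ⟨x, hx⟩

lemma le_lowInf {r : ℝ} {n j : ℕ}
    (hr : ∀ x ∈ Set.Icc (dyadic hab n j) (dyadic hab n (j + 1)), r ≤ H x) :
    r ≤ lowInf hab H n j := by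
  have : Nonempty (Set.Icc (dyadic hab n j) (dyadic hab n (j + 1))) :=
    ⟨⟨_, le_rfl, monotone_dyadic hab n j.le_succ⟩⟩
  exact le_ciInf fun x => hr x x.2

/-- A dyadic interval of index `j` lies in its parent of index `j / 2`, and infima grow on smaller
sets; hence the weights of the atoms are non-negative. -/
lemma lowInf_div_two_le (hH : ∀ x, 0 ≤ H x) (n j : ℕ) :
    lowInf hab H n (j / 2) ≤ lowInf hab H (n + 1) j := by
  have h1 : dyadic hab n (j / 2) ≤ dyadic hab (n + 1) j := by
    rw [← dyadic_succ_two_mul hab n (j / 2)]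
    exact monotone_dyadic hab (n + 1) (by lia)
  have h2 : dyadic hab (n + 1) (j + 1) ≤ dyadic hab n (j / 2 + 1) := by
    rw [← dyadic_succ_two_mul hab n (j / 2 + 1)]
    exact monotone_dyadic hab (n + 1) (by lia)
  exact le_lowInf hab fun x hx => lowInf_le hab hH ⟨h1.trans hx.1, hx.2.trans h2⟩

variable (H)

/-- The lower Darboux sum of `H` against `f` along the dyadic partition. -/
def lowSum (f : Set.Icc a b → ℝ) (n : ℕ) : ℝ :=
  ∑ j ∈ Finset.range (2 ^ n),
    lowInf hab H n j * (f (dyadic hab n (j + 1)) - f (dyadic hab n j))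

/-- The increase of the infimum of `H` from a dyadic interval to one of its halves. -/
def lowIncr : ℕ → ℕ → ℝ
  | 0, j => lowInf hab H 0 j
  | n + 1, j => lowInf hab H (n + 1) j - lowInf hab H n (j / 2)

/-- The contribution of the dyadic intervals of generation `n` to `lowSum`. -/
def layerSum (f : Set.Icc a b → ℝ) (n : ℕ) : ℝ :=
  ∑ j ∈ Finset.range (2 ^ n),
    lowIncr hab H n j * (f (dyadic hab n (j + 1)) - f (dyadic hab n j))

/-- The measure placing at the end points of every dyadic interval the increase of the infimum. -/
def layerMeasure : Measure (Set.Icc a b × Set.Icc a b) :=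
  Measure.sum fun n => ∑ j ∈ Finset.range (2 ^ n), ENNReal.ofReal (lowIncr hab H n j) •
    Measure.dirac (dyadic hab n j, dyadic hab n (j + 1))

/-- The increment of `f` over an interval splits over its halves, so the infima of the parents
cancel between generations. -/
lemma sum_layerSum (f : Set.Icc a b → ℝ) (n : ℕ) :
    ∑ i ∈ Finset.range (n + 1), layerSum hab H f i = lowSum hab H f n := by
  induction n with
  | zero => simp [layerSum, lowSum, lowIncr]
  | succ n ih =>
    have h1 : lowSum hab H f n = ∑ j ∈ Finset.range (2 ^ (n + 1)), lowInf hab H n (j / 2) *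
        (f (dyadic hab (n + 1) (j + 1)) - f (dyadic hab (n + 1) j)) := by
      rw [pow_succ, mul_comm, sum_range_two_mul, lowSum]
      refine Finset.sum_congr rfl fun j _ => ?_
      rw [show (2 * j) / 2 = j by lia, show (2 * j + 1) / 2 = j by lia,
        show 2 * j + 1 + 1 = 2 * (j + 1) by ring, dyadic_succ_two_mul, dyadic_succ_two_mul]
      ring
    rw [Finset.sum_range_succ, ih, h1, layerSum, lowSum, ← Finset.sum_add_distrib]
    refine Finset.sum_congr rfl fun j _ => ?_
    rw [lowIncr]
    ring

variable {H}

lemma lowIncr_nonneg (hH : ∀ x, 0 ≤ H x) : ∀ n j : ℕ, 0 ≤ lowIncr hab H n j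
  | 0, _ => le_lowInf hab fun x _ => hH x
  | n + 1, j => sub_nonneg.2 (lowInf_div_two_le hab hH n j)

lemma dyadic_sub_nonneg (n j : ℕ) : 0 ≤ (dyadic hab n (j + 1) : ℝ) - dyadic hab n j :=
  sub_nonneg.2 (monotone_dyadic hab n j.le_succ)

lemma layerSum_coe_nonneg (hH : ∀ x, 0 ≤ H x) (n : ℕ) :
    0 ≤ layerSum hab H (fun x => (x : ℝ)) n :=
  Finset.sum_nonneg fun j _ => mul_nonneg (lowIncr_nonneg hab hH n j) (dyadic_sub_nonneg hab n j)

lemma monotone_lowSum_coe (hH : ∀ x, 0 ≤ H x) : Monotone (lowSum hab H (fun x => (x : ℝ))) := by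
  refine monotone_nat_of_le_succ fun n => ?_
  rw [← sum_layerSum, ← sum_layerSum, Finset.sum_range_succ _ (n + 1)]
  linarith [layerSum_coe_nonneg hab hH (n + 1)]

lemma energy_layerMeasure (hH : ∀ x, 0 ≤ H x) : energy 1 (layerMeasure hab H) =
    ∑' n, ENNReal.ofReal (layerSum hab H (fun x => (x : ℝ)) n) := by
  rw [energy, layerMeasure, lintegral_sum_measure]
  congr 1
  funext n
  rw [lintegral_finsetSum_measure, layerSum, ENNReal.ofReal_sum_of_nonneg fun j _ =>
    mul_nonneg (lowIncr_nonneg hab hH n j) (dyadic_sub_nonneg hab n j)]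
  refine Finset.sum_congr rfl fun j _ => ?_
  have hm : Measurable fun x : Set.Icc a b × Set.Icc a b =>
      ENNReal.ofReal (|(x.2 : ℝ) - x.1| ^ (1 : ℝ)) := by fun_prop
  rw [lintegral_smul_measure, lintegral_dirac' _ hm, Real.rpow_one,
    abs_of_nonneg (dyadic_sub_nonneg hab n j), ENNReal.ofReal_mul (lowIncr_nonneg hab hH n j),
    smul_eq_mul]

/-- The Hölder bound dominates the integrand by the energy density, although `π` may be infinite. -/
lemma integrable_of_energy_lt_top {α M : ℝ} (hM : 0 ≤ M) (hα : 0 < α) {f : Set.Icc a b → ℝ}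
    (hf : IsHolder M α f) {π : Measure (Set.Icc a b × Set.Icc a b)} (hπ : energy α π < ∞) :
    Integrable (fun x : Set.Icc a b × Set.Icc a b => f x.2 - f x.1) π := by
  have hfc := hf.continuous hα
  refine ⟨(by fun_prop : Continuous fun x : Set.Icc a b × Set.Icc a b =>
    f x.2 - f x.1).aestronglyMeasurable, ?_⟩
  refine lt_of_le_of_lt ?_ (ENNReal.mul_lt_top (ENNReal.ofReal_lt_top (r := M)) hπ)
  rw [energy, ← lintegral_const_mul' _ _ ENNReal.ofReal_ne_top]
  refine lintegral_mono fun x => ?_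
  rw [← ENNReal.ofReal_mul hM, Real.enorm_eq_ofReal_abs]
  exact ENNReal.ofReal_le_ofReal (hf _ _)

lemma tendsto_lowSum (hH : ∀ x, 0 ≤ H x) (hE : energy 1 (layerMeasure hab H) < ∞) {M : ℝ}
    (hM : 0 ≤ M) {f : Set.Icc a b → ℝ} (hf : IsHolder M 1 f) :
    Tendsto (lowSum hab H f) atTop (𝓝 (∫ x, (f x.2 - f x.1) ∂(layerMeasure hab H))) := by
  have hint := integrable_of_energy_lt_top hM one_pos hf hE
  have h1 := hasSum_integral_measure hint
  have h2 : ∀ n, ∫ x : Set.Icc a b × Set.Icc a b, (f x.2 - f x.1)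
      ∂(∑ j ∈ Finset.range (2 ^ n), ENNReal.ofReal (lowIncr hab H n j) •
        Measure.dirac (dyadic hab n j, dyadic hab n (j + 1))) = layerSum hab H f n := by
    intro n
    rw [integral_finsetSum_measure, layerSum]
    · refine Finset.sum_congr rfl fun j _ => ?_
      rw [integral_smul_measure, integral_dirac, ENNReal.toReal_ofReal (lowIncr_nonneg hab hH n j),
        smul_eq_mul]
    · intro j _
      exact (integrable_dirac (by simp)).smul_measure ENNReal.ofReal_ne_top
  simp only [h2] at h1
  have h3 := (tendsto_add_atTop_iff_nat 1).2 h1.tendsto_sum_nat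
  simp only [sum_layerSum] at h3
  exact h3

end Dyadic

/-! ### The explicit coupling for `α = 1` -/

section Lipschitz

variable {a b q V : ℝ} {g : Set.Icc a b → ℝ}

/-- A `1`-Lipschitz function with given slopes along a monotone sequence. -/
lemma exists_lipschitz_of_slopes (t : ℕ → Set.Icc a b) (ht : Monotone t) (σ : ℕ → ℝ)
    (hσ : ∀ j, |σ j| ≤ 1) : ∃ f : Set.Icc a b → ℝ, IsHolder 1 1 f ∧
      ∀ j, f (t (j + 1)) - f (t j) = σ j * ((t (j + 1) : ℝ) - t j) := by
  set F : ℕ → ℝ := fun j => ∑ i ∈ Finset.range j, σ i * ((t (i + 1) : ℝ) - t i) with hF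
  have hle : ∀ i j, i ≤ j → |F j - F i| ≤ |(t j : ℝ) - t i| := by
    intro i j hij
    rw [abs_of_nonneg (sub_nonneg.2 (ht hij) : (0 : ℝ) ≤ t j - t i)]
    induction j, hij using Nat.le_induction with
    | base => simp
    | succ j hij ih =>
      have h1 : F (j + 1) = F j + σ j * ((t (j + 1) : ℝ) - t j) := Finset.sum_range_succ _ _
      have h2 : |σ j * ((t (j + 1) : ℝ) - t j)| ≤ (t (j + 1) : ℝ) - t j := by
        have h3 : (0 : ℝ) ≤ t (j + 1) - t j := sub_nonneg.2 (ht j.le_succ)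
        rw [abs_mul, abs_of_nonneg h3]
        exact mul_le_of_le_one_left h3 (hσ j)
      rw [h1, abs_le] at *
      constructor <;> linarith [ih.1, ih.2, h2.1, h2.2]
  have hle' : ∀ i j, |F j - F i| ≤ |(t j : ℝ) - t i| := by
    intro i j
    rcases le_total i j with h | h
    · exact hle i j h
    · rw [abs_sub_comm, abs_sub_comm (t j : ℝ)]; exact hle j i h
  -- The sequence may repeat points, so `F` must be seen to define a function on its range before it
  -- is extended to a Lipschitz function.
  have hfac : Function.FactorsThrough F t := fun i j hij => by
    have := hle' j i
    rw [hij, sub_self, abs_zero] at this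
    exact sub_eq_zero.1 (abs_nonpos_iff.1 this)
  have hlip : LipschitzOnWith 1 (Function.extend t F 0) (Set.range t) := by
    refine LipschitzOnWith.of_dist_le_mul ?_
    rintro _ ⟨i, rfl⟩ _ ⟨j, rfl⟩
    rw [hfac.extend_apply, hfac.extend_apply, NNReal.coe_one, one_mul]
    exact hle' j i
  obtain ⟨f, hf, hfF⟩ := hlip.extend_real
  refine ⟨f, fun s u => ?_, fun j => ?_⟩
  · rw [Real.rpow_one]
    exact hf.dist_le_mul u s
  · rw [← hfF ⟨_, rfl⟩, ← hfF ⟨_, rfl⟩, hfac.extend_apply, hfac.extend_apply]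
    simp only [hF, Finset.sum_range_succ]
    ring

/-- Summation by parts. -/
lemma seqSum_eq_neg_sum (f : Set.Icc a b → ℝ) (t : ℕ → Set.Icc a b) (m : ℕ) (r : ℝ) :
    seqSum f g t m = f (t m) * (g (t m) - r) - f (t 0) * (g (t 0) - r) -
      ∑ j ∈ Finset.range m, (g (t (j + 1)) - r) * (f (t (j + 1)) - f (t j)) := by
  induction m with
  | zero => simp [seqSum]
  | succ m ih =>
    have : seqSum f g t (m + 1) = seqSum f g t m + f (t m) * (g (t (m + 1)) - g (t m)) :=
      Finset.sum_range_succ _ _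
    rw [this, ih, Finset.sum_range_succ]
    ring

/-- Summation by parts with reference value `g a`: both boundary terms vanish because `g a = g b`,
and left-point sums become right-point sums. -/
lemma YoungData.dyadicPartition_sum (d : YoungData 1 q V g)
    (hg : ∀ x y : Set.Icc a b, (x : ℝ) = a → (y : ℝ) = b → g x = g y) (f : Set.Icc a b → ℝ)
    (n : ℕ) : (dyadicPartition d.lt n).sum f g = -∑ j ∈ Finset.range (2 ^ n),
      (g (dyadic d.lt n (j + 1)) - g ⟨a, le_rfl, d.lt.le⟩) *
        (f (dyadic d.lt n (j + 1)) - f (dyadic d.lt n j)) := by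
  have h0 : g (dyadic d.lt n 0) = g ⟨a, le_rfl, d.lt.le⟩ := by
    congr 1; apply Subtype.ext; rw [dyadic_coe]; simp
  have h1 : g (dyadic d.lt n (2 ^ n)) = g ⟨a, le_rfl, d.lt.le⟩ := by
    refine (hg _ _ rfl ?_).symm
    rw [dyadic_coe, min_self]
    push_cast
    rw [div_self (by positivity)]; ring
  rw [Partition.sum_eq_seqSum, dyadicPartition_m,
    seqSum_eq_neg_sum f _ _ (g ⟨a, le_rfl, d.lt.le⟩)]
  change f (dyadic d.lt n (2 ^ n)) * (g (dyadic d.lt n (2 ^ n)) - _) -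
    f (dyadic d.lt n 0) * (g (dyadic d.lt n 0) - _) - _ = _
  rw [h0, h1, sub_self, mul_zero, mul_zero, sub_zero, zero_sub]
  rfl

/-- The lower Darboux sums have the same limit as the right-point sums, for every non-negative
function whose oscillation is bounded by that of `g`. -/
lemma YoungData.tendsto_sum_sub_lowSum (d : YoungData 1 q V g) {H : Set.Icc a b → ℝ}
    (hH : ∀ x, 0 ≤ H x) (hHg : ∀ x y, |H x - H y| ≤ |g x - g y|) {M : ℝ} (hM : 0 ≤ M)
    {f : Set.Icc a b → ℝ} (hf : IsHolder M 1 f) :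
    Tendsto (fun n => ∑ j ∈ Finset.range (2 ^ n), H (dyadic d.lt n (j + 1)) *
      (f (dyadic d.lt n (j + 1)) - f (dyadic d.lt n j)) - lowSum d.lt H f n) atTop (𝓝 0) := by
  have hq : 0 < q := by linarith [d.one_lt]
  -- The oscillation of `H` over a dyadic interval is at most the control of `g` to the power `1 /
  -- q`, so the error is a sum already estimated for Young's inequality.
  have hosc : ∀ n j, |H (dyadic d.lt n (j + 1)) - lowInf d.lt H n j| ≤
      control q g (dyadic d.lt n j) (dyadic d.lt n (j + 1)) ^ (1 / q) := by
    intro n j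
    have hmem : dyadic d.lt n (j + 1) ∈ Set.Icc (dyadic d.lt n j) (dyadic d.lt n (j + 1)) :=
      ⟨monotone_dyadic d.lt n j.le_succ, le_rfl⟩
    rw [abs_of_nonneg (sub_nonneg.2 (lowInf_le d.lt hH hmem)), sub_le_comm]
    refine le_lowInf d.lt fun x hx => ?_
    have h1 := abs_sub_rpow_le_control d.bound hmem hx
    have h2 := Real.rpow_le_rpow (by positivity) h1 (by positivity : 0 ≤ 1 / q)
    rw [← Real.rpow_mul (abs_nonneg _), mul_one_div_cancel hq.ne', Real.rpow_one] at h2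
    linarith [(abs_le.1 (hHg (dyadic d.lt n (j + 1)) x)).2]
  have hlim := (d.tendsto_err (M * ((b - a) ^ (1 - 1 / q) * V ^ (1 / q)))).comp
    (tendsto_dyadicPartition d.lt)
  refine squeeze_zero_norm (fun n => ?_) hlim
  rw [lowSum, ← Finset.sum_sub_distrib, Real.norm_eq_abs]
  refine (Finset.abs_sum_le_sum_abs _ _).trans ?_
  have hterm : ∀ j ∈ Finset.range (2 ^ n), |H (dyadic d.lt n (j + 1)) *
      (f (dyadic d.lt n (j + 1)) - f (dyadic d.lt n j)) - lowInf d.lt H n j *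
        (f (dyadic d.lt n (j + 1)) - f (dyadic d.lt n j))| ≤
      M * (((dyadic d.lt n (j + 1) : ℝ) - dyadic d.lt n j) ^ (1 : ℝ) *
        control q g (dyadic d.lt n j) (dyadic d.lt n (j + 1)) ^ (1 / q)) := by
    intro j _
    have h1 := hf (dyadic d.lt n j) (dyadic d.lt n (j + 1))
    rw [abs_of_nonneg (dyadic_sub_nonneg d.lt n j)] at h1
    have h2 := Real.rpow_nonneg (dyadic_sub_nonneg d.lt n j) 1
    rw [← sub_mul, abs_mul]
    refine (mul_le_mul (hosc n j) h1 (abs_nonneg _)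
      (Real.rpow_nonneg (control_nonneg _ _ _ _) _)).trans_eq (by ring)
  refine (Finset.sum_le_sum hterm).trans ?_
  rw [← Finset.mul_sum, Function.comp_apply, mul_assoc]
  refine mul_le_mul_of_nonneg_left ?_ hM
  rw [← dyadicPartition_m d.lt n]
  exact sum_rpow_mul_control_le d.one_lt d.lt_exp.le d.bound _ (monotone_dyadic d.lt n) _
    (dyadicPartition d.lt n).mesh_nonneg fun i hi => (dyadicPartition d.lt n).seq_sub_le_mesh hi

lemma energy_map_swap (α : ℝ) (π : Measure (Set.Icc a b × Set.Icc a b)) :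
    energy α (π.map Prod.swap) = energy α π := by
  rw [energy, energy, lintegral_map (by fun_prop) measurable_swap]
  simp only [Prod.fst_swap, Prod.snd_swap, abs_sub_comm]

lemma YoungData.exists_coupling_one (d : YoungData 1 q V g)
    (hg : ∀ x y : Set.Icc a b, (x : ℝ) = a → (y : ℝ) = b → g x = g y) {W : ℝ}
    (hW : ∀ f L, IsHolder 1 1 f → HasYoungIntegral f g L → L ≤ W) :
    ∃ π ∈ couplings 1 g, energy 1 π ≤ ENNReal.ofReal W := by
  set r := g ⟨a, le_rfl, d.lt.le⟩ with hr
  set H : Set.Icc a b → ℝ := fun x => max (g x - r) 0 with hH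
  set H' : Set.Icc a b → ℝ := fun x => max (-(g x - r)) 0 with hH'
  have hH0 : ∀ x, 0 ≤ H x := fun x => le_max_right _ _
  have hH0' : ∀ x, 0 ≤ H' x := fun x => le_max_right _ _
  have hHg : ∀ x y, |H x - H y| ≤ |g x - g y| := fun x y => by
    refine (abs_max_sub_max_le_abs _ _ _).trans_eq ?_
    rw [sub_sub_sub_cancel_right]
  have hHg' : ∀ x y, |H' x - H' y| ≤ |g x - g y| := fun x y => by
    refine (abs_max_sub_max_le_abs _ _ _).trans_eq ?_
    rw [abs_sub_comm]; congr 1; ring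
  have hsub : ∀ x, g x - r = H x - H' x := fun x => (max_zero_sub_max_neg_zero_eq_self _).symm
  have hadd : ∀ x, |g x - r| = H x + H' x := fun x => by
    rw [hH, hH']
    rcases le_total 0 (g x - r) with h | h
    · dsimp only
      rw [max_eq_left h, max_eq_right (neg_nonpos.2 h), abs_of_nonneg h, add_zero]
    · dsimp only
      rw [max_eq_right h, max_eq_left (neg_nonneg.2 h), abs_of_nonpos h, zero_add]
  set S : ℕ → ℝ := fun n => lowSum d.lt H (fun x => (x : ℝ)) n +
    lowSum d.lt H' (fun x => (x : ℝ)) n with hS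
  have hSmono : Monotone S := (monotone_lowSum_coe d.lt hH0).add (monotone_lowSum_coe d.lt hH0')
  -- The test function has slope opposite in sign to `g - r` at right end points. Its Riemann sum is
  -- the sum of `|g - r|` times lengths, which dominates `S m`, and it is at most `W` up to an error
  -- tending to zero.
  have hSW : ∀ n, S n ≤ W := by
    have hlim := ((d.tendsto_err (errConst a b 1 q V * 1)).comp
      (tendsto_dyadicPartition d.lt)).const_add W
    rw [add_zero] at hlim
    intro n
    refine ge_of_tendsto hlim (eventually_atTop.2 ⟨n, fun m hnm => (hSmono hnm).trans ?_⟩)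
    obtain ⟨f, hf, hfs⟩ := exists_lipschitz_of_slopes (dyadic d.lt m) (monotone_dyadic d.lt m)
      (fun j => if 0 ≤ g (dyadic d.lt m (j + 1)) - r then -1 else 1)
      (fun j => by split_ifs <;> simp)
    obtain ⟨L, hL⟩ := d.exists_hasYoungIntegral zero_le_one hf
    have h1 := d.abs_sum_sub_le zero_le_one hf hL (dyadicPartition d.lt m)
    have h2 : S m ≤ (dyadicPartition d.lt m).sum f g := by
      rw [d.dyadicPartition_sum hg, ← Finset.sum_neg_distrib, hS]
      dsimp only
      rw [lowSum, lowSum, ← Finset.sum_add_distrib]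
      refine Finset.sum_le_sum fun j _ => ?_
      have hmem : dyadic d.lt m (j + 1) ∈ Set.Icc (dyadic d.lt m j) (dyadic d.lt m (j + 1)) :=
        ⟨monotone_dyadic d.lt m j.le_succ, le_rfl⟩
      have h3 := lowInf_le d.lt hH0 hmem
      have h4 := lowInf_le d.lt hH0' hmem
      have h5 := dyadic_sub_nonneg d.lt m j
      have h6 : -((g (dyadic d.lt m (j + 1)) - r) *
          (f (dyadic d.lt m (j + 1)) - f (dyadic d.lt m j))) =
          |g (dyadic d.lt m (j + 1)) - r| *
            ((dyadic d.lt m (j + 1) : ℝ) - dyadic d.lt m j) := by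
        rw [hfs]
        split_ifs with h
        · rw [abs_of_nonneg h]; ring
        · rw [abs_of_neg (not_le.1 h)]; ring
      rw [← add_mul, h6, hadd]
      exact mul_le_mul_of_nonneg_right (add_le_add h3 h4) h5
    have h3 := hW f L hf hL
    have h4 := (abs_le.1 h1).2
    rw [Function.comp_apply]
    linarith
  -- Summation by parts carries a minus sign, so the atoms of the positive part are reversed.
  set π := (layerMeasure d.lt H).map Prod.swap + layerMeasure d.lt H' with hπ
  have hEadd : energy 1 π = energy 1 (layerMeasure d.lt H) + energy 1 (layerMeasure d.lt H') := by
    rw [hπ, energy, lintegral_add_measure]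
    exact congrArg₂ _ (energy_map_swap 1 _) rfl
  have henergy : energy 1 π ≤ ENNReal.ofReal W := by
    rw [hEadd, energy_layerMeasure d.lt hH0, energy_layerMeasure d.lt hH0', ← ENNReal.tsum_add]
    refine ENNReal.tsum_le_of_sum_range_le fun n => ?_
    have h1 : ∀ i, 0 ≤ layerSum d.lt H (fun x => (x : ℝ)) i +
        layerSum d.lt H' (fun x => (x : ℝ)) i := fun i =>
      add_nonneg (layerSum_coe_nonneg d.lt hH0 i) (layerSum_coe_nonneg d.lt hH0' i)
    simp only [← ENNReal.ofReal_add (layerSum_coe_nonneg d.lt hH0 _)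
      (layerSum_coe_nonneg d.lt hH0' _)]
    rw [← ENNReal.ofReal_sum_of_nonneg fun i _ => h1 i]
    refine ENNReal.ofReal_le_ofReal ?_
    refine le_trans (Finset.sum_le_sum_of_subset_of_nonneg
      (Finset.range_mono n.le_succ) fun i _ _ => h1 i) ?_
    rw [Nat.succ_eq_add_one, Finset.sum_add_distrib, sum_layerSum, sum_layerSum]
    exact hSW n
  have hlt : energy 1 (layerMeasure d.lt H) + energy 1 (layerMeasure d.lt H') < ∞ :=
    hEadd ▸ henergy.trans_lt ENNReal.ofReal_lt_top
  have hE : energy 1 (layerMeasure d.lt H) < ∞ := (ENNReal.add_lt_top.1 hlt).1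
  have hE' : energy 1 (layerMeasure d.lt H') < ∞ := (ENNReal.add_lt_top.1 hlt).2
  refine ⟨π, ⟨henergy.trans_lt ENNReal.ofReal_lt_top, fun f hf => ?_⟩, henergy⟩
  obtain ⟨M, hM, hfM⟩ := exists_isHolder_of_lt_top hf
  obtain ⟨L, hL⟩ := d.exists_hasYoungIntegral hM hfM
  have hlim : Tendsto (fun n => (dyadicPartition d.lt n).sum f g) atTop (𝓝 L) :=
    hL.comp (tendsto_dyadicPartition d.lt)
  have hlim' := ((d.tendsto_sum_sub_lowSum hH0' hHg' hM hfM).add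
    (tendsto_lowSum d.lt hH0' hE' hM hfM)).sub ((d.tendsto_sum_sub_lowSum hH0 hHg hM hfM).add
      (tendsto_lowSum d.lt hH0 hE hM hfM))
  have hint : ∫ x, (f x.2 - f x.1) ∂π =
      0 + ∫ x, (f x.2 - f x.1) ∂(layerMeasure d.lt H') -
        (0 + ∫ x, (f x.2 - f x.1) ∂(layerMeasure d.lt H)) := by
    have hsw : Integrable (fun x : Set.Icc a b × Set.Icc a b => f x.2 - f x.1)
        ((layerMeasure d.lt H).map Prod.swap) :=
      integrable_of_energy_lt_top hM one_pos hfM (by rwa [energy_map_swap])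
    rw [hπ, integral_add_measure hsw (integrable_of_energy_lt_top hM one_pos hfM hE'),
      integral_map measurable_swap.aemeasurable hsw.aestronglyMeasurable]
    simp only [Prod.fst_swap, Prod.snd_swap]
    have : ∫ x : Set.Icc a b × Set.Icc a b, (f x.1 - f x.2) ∂(layerMeasure d.lt H) =
        -∫ x, (f x.2 - f x.1) ∂(layerMeasure d.lt H) := by
      rw [← integral_neg]; simp only [neg_sub]
    rw [this]; ring
  rw [hint]
  rwa [← tendsto_nhds_unique hlim (hlim'.congr fun n => ?_)]
  rw [d.dyadicPartition_sum hg, sub_add_cancel, sub_add_cancel, ← Finset.sum_sub_distrib,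
    ← Finset.sum_neg_distrib]
  refine Finset.sum_congr rfl fun j _ => ?_
  rw [← hr, hsub]
  ring

end Lipschitz

/-! ### Lower bound, maximisers and the theorem -/

section Conclusion

variable {a b : ℝ}

lemma isHolder_dist_rpow {α : ℝ} (hα : 0 < α) (hα1 : α ≤ 1) (c : Set.Icc a b) :
    IsHolder 1 α fun t : Set.Icc a b => |(t : ℝ) - c| ^ α := by
  have key : ∀ s t : Set.Icc a b,
      |(t : ℝ) - c| ^ α - |(s : ℝ) - c| ^ α ≤ |(t : ℝ) - s| ^ α := fun s t => by
    have h1 := Real.rpow_le_rpow (abs_nonneg _) (abs_sub_le (t : ℝ) s c) hα.le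
    have h2 := Real.rpow_add_le_add_rpow (abs_nonneg ((t : ℝ) - s)) (abs_nonneg ((s : ℝ) - c))
      hα.le hα1
    linarith
  intro s t
  have h1 := key t s
  rw [abs_sub_comm (s : ℝ) t] at h1
  rw [one_mul]
  exact abs_le.2 ⟨by linarith, key s t⟩

/-- A function of semi-norm exactly one vanishing at `c`, for use as maximiser when all integrals
are zero. -/
lemma holderSeminorm_dist_rpow (hab : a < b) {α : ℝ} (hα : 0 < α) (hα1 : α ≤ 1)
    (c : Set.Icc a b) : holderSeminorm α (fun t : Set.Icc a b => |(t : ℝ) - c| ^ α) = 1 := by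
  refine le_antisymm ?_ ?_
  · simpa using (isHolder_dist_rpow hα hα1 c).holderSeminorm_le
  · have : Nontrivial (Set.Icc a b) :=
      ⟨⟨a, le_rfl, hab.le⟩, ⟨b, hab.le, le_rfl⟩, fun h => hab.ne (congrArg Subtype.val h)⟩
    obtain ⟨t, ht⟩ := exists_ne c
    have h0 : 0 < |(t : ℝ) - c| := abs_pos.2 (sub_ne_zero.2 fun h => ht (Subtype.ext h))
    have h1 : ENNReal.ofReal
        (abs (|(t : ℝ) - c| ^ α - |(c : ℝ) - c| ^ α) / |(t : ℝ) - c| ^ α) = 1 := by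
      rw [sub_self, abs_zero, Real.zero_rpow hα.ne', sub_zero, abs_of_nonneg (by positivity),
        div_self (by positivity), ENNReal.ofReal_one]
    rw [← h1]
    exact le_iSup_of_le c (le_iSup_of_le t (le_iSup_of_le (f := fun _ : c ≠ t => ENNReal.ofReal
      (abs (|(t : ℝ) - c| ^ α - |(c : ℝ) - c| ^ α) / |(t : ℝ) - c| ^ α)) ht.symm le_rfl))

lemma ofReal_le_energy {α : ℝ} {g f : Set.Icc a b → ℝ} (hab : a < b) (hf : IsHolder 1 α f) {W : ℝ}
    (hW : HasYoungIntegral f g W) {π : Measure (Set.Icc a b × Set.Icc a b)}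
    (hπ : π ∈ couplings α g) : ENNReal.ofReal W ≤ energy α π := by
  have h1 := hπ.2 f (hf.holderSeminorm_le.trans_lt ENNReal.ofReal_lt_top)
  rw [hW.unique hab h1]
  refine (ENNReal.ofReal_le_ofReal (le_abs_self _)).trans ?_
  rw [← Real.enorm_eq_ofReal_abs]
  refine (enorm_integral_le_lintegral_enorm _).trans (lintegral_mono fun x => ?_)
  rw [Real.enorm_eq_ofReal_abs]
  refine ENNReal.ofReal_le_ofReal ?_
  have := hf x.1 x.2
  rwa [one_mul] at this

lemma YoungData.exists_coupling {α q V : ℝ} {g : Set.Icc a b → ℝ} (d : YoungData α q V g)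
    (hg : ∀ x y : Set.Icc a b, (x : ℝ) = a → (y : ℝ) = b → g x = g y) (hα1 : α ≤ 1) {W : ℝ}
    (hW : ∀ f L, IsHolder 1 α f → HasYoungIntegral f g L → L ≤ W) :
    ∃ π ∈ couplings α g, energy α π ≤ ENNReal.ofReal W := by
  rcases hα1.lt_or_eq with h | rfl
  · exact d.exists_coupling_of_lt_one hg h hW
  · exact d.exists_coupling_one hg hW

lemma YoungData.exists_maximizer {α q V : ℝ} {g : Set.Icc a b → ℝ} (d : YoungData α q V g)
    (hg : ∀ x y : Set.Icc a b, (x : ℝ) = a → (y : ℝ) = b → g x = g y) (hα1 : α ≤ 1)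
    (c : Set.Icc a b) : ∃ (f : Set.Icc a b → ℝ) (W : ℝ), f c = 0 ∧ holderSeminorm α f = 1 ∧
      HasYoungIntegral f g W ∧ ∀ f' L, IsHolder 1 α f' → HasYoungIntegral f' g L → L ≤ W := by
  have hα := d.exp_pos
  obtain ⟨f, W, hfc, hf, hfW, hW⟩ := d.exists_isMaxOn hg c
  have hW0 : 0 ≤ W := hW 0 0 ((isHolder_zero α).mono zero_le_one) (hasYoungIntegral_zero g)
  -- If `W = 0`, testing a function and its negative shows that every integral vanishes. If `W > 0`,
  -- a maximiser of semi-norm below one would contradict homogeneity.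
  rcases hW0.eq_or_lt with rfl | hWpos
  · have h1 := isHolder_dist_rpow hα hα1 c
    obtain ⟨L, hL⟩ := d.exists_hasYoungIntegral zero_le_one h1
    have h2 := hW _ _ h1 hL
    have h3 := h1.const_smul (-1)
    rw [abs_neg, abs_one, mul_one] at h3
    have h4 := hW _ _ h3 (hL.const_smul (-1))
    obtain rfl : L = 0 := by linarith
    exact ⟨_, 0, by simp [Real.zero_rpow hα.ne'], holderSeminorm_dist_rpow d.lt hα hα1 c, hL, hW⟩
  · refine ⟨f, W, hfc, le_antisymm (by simpa using hf.holderSeminorm_le) ?_, hfW, hW⟩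
    by_contra! hlt
    have h1 := IsHolder.of_holderSeminorm_le ENNReal.toReal_nonneg
      (ENNReal.ofReal_toReal (hlt.trans ENNReal.one_lt_top).ne).ge
    have h2 := le_mul_of_isHolder hW ENNReal.toReal_nonneg h1 hfW
    have h3 := (ENNReal.toReal_lt_toReal (hlt.trans ENNReal.one_lt_top).ne ENNReal.one_ne_top).2 hlt
    rw [ENNReal.toReal_one] at h3
    nlinarith

end Conclusion

end

end KantorovichYoung

theorem proposition4p1 (a b : ℝ) (hab : a < b) (q : ℝ) (hq : 1 < q) (g : Set.Icc a b → ℝ)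
    (hg : KantorovichYoung.pVariation q g < ∞)
    (hgab : g ⟨a, Set.left_mem_Icc.2 hab.le⟩ = g ⟨b, Set.right_mem_Icc.2 hab.le⟩)
    (α : ℝ) (hα : 1 - 1 / q < α) (hα1 : α ≤ 1) (c : Set.Icc a b) :
    -- the Young integral against `g` exists for every `α`-Hölder function
    (∀ f : Set.Icc a b → ℝ, KantorovichYoung.holderSeminorm α f < ∞ →
      ∃ L : ℝ, KantorovichYoung.HasYoungIntegral f g L) ∧
    -- the supremum is finite, over the unit ball of the norm as well as of the semi-norm
    IsLUB (KantorovichYoung.normBallValues c α g) (KantorovichYoung.kantorovichYoung c α g) ∧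
    IsLUB (KantorovichYoung.seminormBallValues α g) (KantorovichYoung.kantorovichYoung c α g) ∧
    -- it is attained by some `f` of semi-norm exactly one
    (∃ f : Set.Icc a b → ℝ, KantorovichYoung.holderNorm c α f ≤ 1 ∧
      KantorovichYoung.holderSeminorm α f = 1 ∧
      KantorovichYoung.HasYoungIntegral f g (KantorovichYoung.kantorovichYoung c α g)) ∧
    -- and it is the minimal energy of a coupling, a minimum that is attained
    IsLeast (KantorovichYoung.energy α '' KantorovichYoung.couplings α g)
      (ENNReal.ofReal (KantorovichYoung.kantorovichYoung c α g)) := by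
  have hq0 : 0 < q := by linarith
  have d : KantorovichYoung.YoungData α q _ g :=
    ⟨hab, hq, hα, KantorovichYoung.varSum_le_of_pVariation_lt_top hq0 hg⟩
  have hg' : ∀ x y : Set.Icc a b, (x : ℝ) = a → (y : ℝ) = b → g x = g y := by
    intro x y hx hy
    rw [show x = ⟨a, Set.left_mem_Icc.2 hab.le⟩ from Subtype.ext hx, hgab]
    exact congrArg g (Subtype.ext hy.symm)
  obtain ⟨f, W, hfc, hf, hfW, hW⟩ := d.exists_maximizer hg' hα1 c
  have hnorm : KantorovichYoung.holderNorm c α f ≤ 1 := by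
    simp [KantorovichYoung.holderNorm, hfc, hf]
  have hball : ∀ f' L, KantorovichYoung.holderSeminorm α f' ≤ 1 →
      KantorovichYoung.HasYoungIntegral f' g L → L ≤ W := fun f' L hf' hL =>
    hW f' L (.of_holderSeminorm_le zero_le_one (by simpa using hf')) hL
  have h1 : IsGreatest (KantorovichYoung.normBallValues c α g) W :=
    ⟨⟨f, hnorm, hfW⟩, fun L ⟨f', hf', hL⟩ => hball f' L (le_add_self.trans hf') hL⟩
  have h2 : IsGreatest (KantorovichYoung.seminormBallValues α g) W :=
    ⟨⟨f, hf.le, hfW⟩, fun L ⟨f', hf', hL⟩ => hball f' L hf' hL⟩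
  have hK : KantorovichYoung.kantorovichYoung c α g = W := h1.csSup_eq
  rw [hK]
  have hfH : KantorovichYoung.IsHolder 1 α f :=
    .of_holderSeminorm_le zero_le_one (by simpa using hf.le)
  obtain ⟨π, hπ, hπW⟩ := d.exists_coupling hg' hα1 hW
  refine ⟨fun f' hf' => ?_, h1.isLUB, h2.isLUB, ⟨f, hnorm, hf, hfW⟩, ⟨π, hπ, ?_⟩, ?_⟩
  · obtain ⟨M, hM, hfM⟩ := KantorovichYoung.exists_isHolder_of_lt_top hf'
    exact d.exists_hasYoungIntegral hM hfM
  · exact hπW.antisymm (KantorovichYoung.ofReal_le_energy hab hfH hfW hπ)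
  · rintro _ ⟨π', hπ', rfl⟩
    exact KantorovichYoung.ofReal_le_energy hab hfH hfW hπ'
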